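/- Let $\mathcal T=\mathbf K(\mathbf{Ab})$ be the homotopy category of cochain complexes of abelian groups. It is a triangulated category with coproducts. A $\mathcal T$-module is a functor $\mathcal T^{op}\to\mathbf{Ab}$, and it is finitely presentable if there is an exact sequence $\mathcal T(-,y)\to\mathcal T(-,x)\to X\to 0$ with $x,y\in\mathcal T$. Let $\mathcal A(\mathcal T)$ be the category of all finitely presentable $\mathcal T$-modules and all natural transformations $\mathrm{Hom}_{\mathcal T}(X,Y)$ between them; it is an abelian category with small Hom-sets and with coproducts (the abelianization of $\mathcal T$). For a regular cardinal $\kappa$ let $\mathbf{Ab}_\kappa$ be the closure under direct sums and direct summands of the class of abelian groups of cardinality smaller than $\kappa$. An $\mathbf{Ab}_\kappa$-precover of an abelian group $A$ is a homomorphism $X_A\to A$ with $X_A\in\mathbf{Ab}_\kappa$ such that $\mathrm{Hom}(X,X_A)\to\mathrm{Hom}(X,A)$ is surjective for all $X\in\mathbf{Ab}_\kappa$; every abelian group has an $\mathbf{Ab}_\kappa$-precover. Given $A$, put $A^0=A$ and, inductively for $n\ge 0$, choose an $\mathbf{Ab}_\kappa$-precover $Y_\kappa^{-n}\to A^{-n}$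 and let $A^{-n-1}$ be its kernel. Let $$Y_{A,\kappa}:\ \cdots\to Y_\kappa^{-2}\to Y_\kappa^{-1}\to Y_\kappa^{0}\to A\to 0$$ be the complex (with $Y_\kappa^{-n}$ in degree $-n$ and $A$ in degree $1$) whose differentials are the precover $Y_\kappa^0\to A$ and the compositions $Y_\kappa^{-n}\to A^{-n}\to Y_\kappa^{-n+1}$, $n\geq 1$. Then, for every choice of these precovers, the product over the class of all regular cardinals $$F=\prod_{\kappa\ \mathrm{regular}}\mathcal T(-,Y_{\mathbb Z^\kappa,\kappa}):\mathcal T^{op}\to\mathbf{Ab}$$ is well defined (its values are small abelian groups), it is cohomological, sends coproducts to products, and is not representable. Moreover $$F^*:\mathcal A(\mathcal T)^{op}\to\mathbf{Ab},\qquad F^*(X)=\mathrm{Hom}_{\mathcal T}(X,F),$$ is well defined (its values are small abelian groups), and it is an exact contravariant functor that sends coproducts to products but is not representable. In particular, there is a non-representable exact contravariant functor $\mathcal A(\mathbf K(\mathbf{Ab}))\to\mathbf{Ab}$ that sends coproducts to products. -/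

import Mathlib

open CategoryTheory CategoryTheory.Limits Opposite
open scoped CategoryTheory.Pretriangulated.Opposite DirectSum

universe u v w

noncomputable section

namespace KAbExample

/-! ### Modules over a preadditive category and the abelianization -/

section Abelianization

variable (T : Type w) [Category.{v} T] [Preadditive T]

/-- A `T`-module `X : Tᵒᵖ ⥤ Ab` is finitely presentable if there is an exact sequence
`T(-, y) ⟶ T(-, x) ⟶ X ⟶ 0`. -/
def finitelyPresentable : ObjectProperty (Tᵒᵖ ⥤ AddCommGrpCat.{v}) := fun X =>
  ∃ (x y : T) (f : preadditiveYoneda.obj y ⟶ preadditiveYoneda.obj x)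
    (p : preadditiveYoneda.obj x ⟶ X) (hfp : f ≫ p = 0),
    (ShortComplex.mk f p hfp).Exact ∧ Epi p

/-- The category `A(T) = mod(T)` of finitely presentable `T`-modules, with all natural
transformations as morphisms (the abelianization, if `T` is triangulated). -/
abbrev Abelianization : Type _ := (finitelyPresentable T).FullSubcategory

variable {T}

/-- For a `T`-module `F`, the contravariant functor `X ↦ Hom_T(X, F)` on `A(T)`. A priori
its values are abelian groups in the larger universe where natural transformations live. -/
def homInto (F : Tᵒᵖ ⥤ AddCommGrpCat.{v}) :
    (Abelianization T)ᵒᵖ ⥤ AddCommGrpCat.{max w v} :=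
  (finitelyPresentable T).ι.op ⋙ preadditiveYoneda.obj F

end Abelianization

/-- A contravariant functor to abelian groups sends `u`-small coproducts to products: whenever
`c` is a coproduct of the `X j`, the canonical map `F(c) ⟶ ∏ j, F(X j)` is bijective. -/
def SendsCoproductsToProducts {C : Type w} [Category.{v} C]
    (F : Cᵒᵖ ⥤ AddCommGrpCat.{u}) : Prop :=
  ∀ (J : Type u) (X : J → C) (c : Cofan X), Nonempty (IsColimit c) →
    Function.Bijective
      (fun (x : F.obj (op c.pt)) (j : J) => (F.map (c.inj j).op).hom x)

/-- A contravariant functor `F` with values in (small) abelian groups is representable if it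
is isomorphic to `Hom(-, X)` for some object `X`; the universe lift only allows for categories
whose morphisms formally live in a larger universe. -/
def IsRepresentableAb {C : Type w} [Category.{max u v} C] [Preadditive C]
    (F : Cᵒᵖ ⥤ AddCommGrpCat.{u}) : Prop :=
  ∃ X : C, Nonempty (F ⋙ AddCommGrpCat.uliftFunctor.{v, u} ≅ preadditiveYoneda.obj X)

/-! ### Precovers by small abelian groups -/

/-- `AbLT κ` is the closure under direct sums and direct summands of the class of all abelian
groups of cardinality smaller than `κ`. -/
inductive AbLT (κ : Cardinal.{u}) : AddCommGrpCat.{u} → Prop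
  | of_card_lt (A : AddCommGrpCat.{u}) (hA : Cardinal.mk A < κ) : AbLT κ A
  | directSum (ι : Type u) (G : ι → AddCommGrpCat.{u}) (hG : ∀ i, AbLT κ (G i)) :
      AbLT κ (AddCommGrpCat.of (⨁ i, G i))
  | directSummand (A B : AddCommGrpCat.{u}) (r : Retract A B) (hB : AbLT κ B) : AbLT κ A

/-- An `AbLT κ`-precover of the abelian group `A`. -/
structure Precover (κ : Cardinal.{u}) (A : AddCommGrpCat.{u}) where
  /-- the source of the precover -/
  obj : AddCommGrpCat.{u}
  mem : AbLT κ obj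
  /-- the precover -/
  map : obj ⟶ A
  exists_lift : ∀ (X : AddCommGrpCat.{u}), AbLT κ X → ∀ g : X ⟶ A, ∃ h : X ⟶ obj, h ≫ map = g

section Resolution

variable {κ : Cardinal.{u}} (c : ℕ → ∀ B : AddCommGrpCat.{u}, Precover κ B)
  (A : AddCommGrpCat.{u})

/-- The group `A⁻ⁿ`: `A⁰ = A`, and `A⁻⁽ⁿ⁺¹⁾` is the kernel of the precover `Y⁻ⁿ ⟶ A⁻ⁿ`. Here
`c n` is the choice of precovers used in the `n`-th step. -/
def syzygy : ℕ → AddCommGrpCat.{u}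
  | 0 => A
  | n + 1 => kernel (c n (syzygy n)).map

/-- The terms `A, Y⁰, Y⁻¹, Y⁻², …`. -/
def resolutionX : ℕ → AddCommGrpCat.{u}
  | 0 => A
  | n + 1 => (c n (syzygy c A n)).obj

/-- The precover `Y⁻ⁿ ⟶ A⁻ⁿ`. -/
def resolutionCover (n : ℕ) : resolutionX c A (n + 1) ⟶ syzygy c A n :=
  (c n (syzygy c A n)).map

/-- The inclusion `A⁻⁽ⁿ⁺¹⁾ ⟶ Y⁻ⁿ` of the kernel, preceded by the identity `A⁰ ⟶ A`. -/
def resolutionIncl : ∀ n, syzygy c A n ⟶ resolutionX c A n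
  | 0 => 𝟙 A
  | n + 1 => kernel.ι (c n (syzygy c A n)).map

lemma resolutionIncl_comp_cover (n : ℕ) :
    resolutionIncl c A (n + 1) ≫ resolutionCover c A n = 0 :=
  kernel.condition (c n (syzygy c A n)).map

/-- The differentials: the compositions `Y⁻ⁿ ⟶ A⁻ⁿ ⟶ Y⁻ⁿ⁺¹` (for `n = 0`, the precover
`Y⁰ ⟶ A`). -/
def resolutionD (n : ℕ) : resolutionX c A (n + 1) ⟶ resolutionX c A n :=
  resolutionCover c A n ≫ resolutionIncl c A n

lemma resolutionD_comp (n : ℕ) : resolutionD c A (n + 1) ≫ resolutionD c A n = 0 := by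
  simp only [resolutionD, Category.assoc]
  rw [← Category.assoc (resolutionIncl c A (n + 1)), resolutionIncl_comp_cover, zero_comp,
    comp_zero]

/-- The cochain complex `⋯ ⟶ Y⁻¹ ⟶ Y⁰ ⟶ A ⟶ 0`, with `Y⁻ⁿ` in degree `-n` and `A` in
degree `1`. -/
def resolution : CochainComplex AddCommGrpCat.{u} ℤ :=
  (ChainComplex.of (resolutionX c A) (resolutionD c A) (resolutionD_comp c A)).extend
    (ComplexShape.embeddingUpIntLE 1)

end Resolution

/-! ### The homotopy category and the functor -/

/-- The homotopy category `K(Ab)` of cochain complexes of abelian groups. -/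
abbrev KAb : Type (u + 1) := HomotopyCategory AddCommGrpCat.{u} (ComplexShape.up ℤ)

/-- The class of all regular cardinals. -/
abbrev RegularCardinal : Type (u + 1) := {κ : Cardinal.{u} // κ.IsRegular}

/-- The abelian group `ℤ^κ`. -/
def intPower (κ : Cardinal.{u}) : AddCommGrpCat.{u} := AddCommGrpCat.of (κ.out → ℤ)

/-- The complex `Y_{ℤ^κ, κ}` as an object of `K(Ab)`. -/
def resolutionIntPower
    (c : ∀ κ : RegularCardinal.{u}, ℕ → ∀ B : AddCommGrpCat.{u}, Precover κ.1 B)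
    (κ : RegularCardinal.{u}) : KAb.{u} :=
  (HomotopyCategory.quotient AddCommGrpCat.{u} (ComplexShape.up ℤ)).obj
    (resolution (c κ) (intPower κ.1))

/-- The product `∏_κ K(Ab)(-, Y κ)` over the class of all regular cardinals; a priori it takes
values in abelian groups of the next universe. -/
def classProduct (Y : RegularCardinal.{u} → KAb.{u}) :
    KAb.{u}ᵒᵖ ⥤ AddCommGrpCat.{u + 1} where
  obj X := AddCommGrpCat.of (∀ κ : RegularCardinal.{u}, X.unop ⟶ Y κ)
  map f := AddCommGrpCat.ofHom
    { toFun := fun g κ => f.unop ≫ g κ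
      map_zero' := by funext κ; simp
      map_add' := fun g h => by funext κ; simp }
  map_id X := by ext g κ; simp
  map_comp f g := by ext h κ; simp

end KAbExample

end

noncomputable section

namespace KAbExample

/-! ### Groups in `AbLT κ` -/

/-! Write Y_κ for Y_{ℤ^κ,κ}. Two opposing properties of these complexes carry the theorem. Each
complex X sees only a set of them. Once κ exceeds the cardinalities of all terms of X, these terms
lie in `AbLT κ`, so maps out of them see the precover resolution as exact. As the resolution is
bounded above, every map X ⟶ Y_κ can be contracted by descending degree (`nonempty_homotopy_zero`,
`hom_resolution_eq_zero`). Hence the product over the class has small values. On the other hand no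
Y_κ vanishes: a contraction would split the precover Y⁰ ⟶ ℤ^κ and put ℤ^κ into `AbLT κ`, which a
diagonal argument in the style of Chase forbids (`exists_eventually_divisible`,
`not_retract_directSum`). If some T(-, Z) ⟶ F were an epimorphism, lifting an element whose
κ-component is the identity would make Y_κ a retract of Z for every κ; for large κ this forces Y_κ =
0 (`not_epi_smallProduct`). So F is not representable, while it inherits exactness on triangles and
the behaviour on coproducts from its factors. On A(T), weak pullbacks obtained from triangles
(`exists_weakPullback`) give closure under kernels, and also make homological functors injective
relative to finitely presentable modules (`Presentation.exists_extension`); hence F^* is exact.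
Coproducts in A(T) are computed from coproducts of generators and relations
(`Presentation.bijective_comp`). A representing object X of F^* would carry a universal map X ⟶ F
hitting every element of F, hence an epimorphism T(-, x) ⟶ F, which is already excluded. -/

/-- Every group in `AbLT κ` is a retract of a direct sum of groups of cardinality `< κ`. -/
lemma AbLT.exists_retract {κ : Cardinal.{u}} {A : AddCommGrpCat.{u}} (hA : AbLT κ A) :
    ∃ (ι : Type u) (C : ι → AddCommGrpCat.{u}) (_ : ∀ i, Cardinal.mk (C i) < κ)
      (f : A →+ ⨁ i, C i) (r : (⨁ i, C i) →+ A), ∀ a, r (f a) = a := by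
  classical
  induction hA with
  | of_card_lt A hA =>
    refine ⟨PUnit, fun _ => A, fun _ => hA, DirectSum.of (fun _ : PUnit => (A : Type u)) ⟨⟩,
      DirectSum.toAddMonoid fun _ => AddMonoidHom.id A, fun a => ?_⟩
    simp
  | directSum ι G hG ih =>
    choose J C hC f r h using ih
    refine ⟨Σ i, J i, fun k => C k.1 k.2, fun k => hC _ _,
      (DirectSum.sigmaUncurry (δ := fun i j => (C i j : Type u))).comp
        (DFinsupp.mapRange.addMonoidHom f),
      (DFinsupp.mapRange.addMonoidHom r).comp
        (DirectSum.sigmaCurry (δ := fun i j => (C i j : Type u))), fun a => ?_⟩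
    have key : ∀ b, DirectSum.sigmaCurry (δ := fun i j => (C i j : Type u))
        (DirectSum.sigmaUncurry (δ := fun i j => (C i j : Type u)) b) = b :=
      fun b => (DirectSum.sigmaCurryEquiv (δ := fun i j => (C i j : Type u))).apply_symm_apply b
    simp only [AddMonoidHom.comp_apply]
    erw [key]
    refine DFinsupp.ext fun i => ?_
    exact h i _
  | directSummand A B s hB ih =>
    obtain ⟨J, C, hC, f, r, h⟩ := ih
    refine ⟨J, C, hC, f.comp s.i.hom, s.r.hom.comp r, fun a => ?_⟩
    simp only [AddMonoidHom.comp_apply, h]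
    exact ConcreteCategory.congr_hom s.retract a

/-! ### Homomorphisms from products to direct sums -/

/-- Chase's diagonal argument. If no such `m`, `N`, `S` exist, counterexamples can be chosen
recursively and summed to one element of the product whose image has infinitely many nonzero
components. -/
lemma exists_eventually_divisible {ι : Type u} {J : Type v} {C : J → Type w}
    [∀ j, AddCommGroup (C j)] (f : (ℕ → ι → ℤ) →+ ⨁ j, C j) :
    ∃ (m N : ℕ) (S : Finset J), 0 < N ∧ ∀ x : ℕ → ι → ℤ, (∀ k < m, x k = 0) →
      ∀ j ∉ S, ∀ M : ℕ, 0 < M → ∃ y : C j, f (N • x) j = M • y := by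
  classical
  by_contra! H
  have H' : ∀ (m : ℕ) (s : ℕ+ × Finset J), ∃ (x : ℕ → ι → ℤ) (j : J) (M : ℕ+),
      (∀ k < m, x k = 0) ∧ j ∉ s.2 ∧ ∀ y : C j, f ((s.1 : ℕ) • x) j ≠ (M : ℕ) • y := by
    intro m s
    obtain ⟨x, hx, j, hj, M, hM, h⟩ := H m s.1 s.2 s.1.pos
    exact ⟨x, j, ⟨M, hM⟩, hx, hj, h⟩
  choose x j M hx hj hM using H'
  -- The state records the multiplier reached so far and the indices to be avoided: all earlier `j`
  -- and the supports of all earlier `f (Y i)`.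
  let step : ℕ → ℕ+ × Finset J → ℕ+ × Finset J := fun n s =>
    (s.1 * M n s, s.2 ∪ {j n s} ∪ (f ((s.1 : ℕ) • x n s)).support)
  let s : ℕ → ℕ+ × Finset J := fun n => Nat.rec (1, ∅) step n
  have hs : ∀ n, s (n + 1) = step n (s n) := fun n => rfl
  let X : ℕ → ℕ → ι → ℤ := fun n => x n (s n)
  let N : ℕ → ℕ := fun n => (s n).1
  let Y : ℕ → ℕ → ι → ℤ := fun n => N n • X n
  let jj : ℕ → J := fun n => j n (s n)
  have hXz : ∀ n k, k < n → X n k = 0 := fun n k hk => hx n (s n) k hk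
  have hNsucc : ∀ n, N (n + 1) = N n * M n (s n) := fun n => by
    simp [N, hs, step]
  have hNdvd : ∀ n m, n ≤ m → N n ∣ N m := by
    intro n m h
    induction m, h using Nat.le_induction with
    | base => exact dvd_rfl
    | succ m _ ih => exact ih.trans (hNsucc m ▸ dvd_mul_right _ _)
  have hSmono : ∀ n m, n ≤ m → (s n).2 ⊆ (s m).2 := by
    intro n m h
    induction m, h using Nat.le_induction with
    | base => exact subset_rfl
    | succ m _ ih =>
      refine ih.trans ?_
      rw [hs]
      simp only [step, Finset.union_assoc]
      exact Finset.subset_union_left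
  have hjmem : ∀ n m, n < m → jj n ∈ (s m).2 := by
    intro n m h
    apply hSmono (n + 1) m h
    rw [hs]
    simp [step, jj]
  have hjinj : Function.Injective jj := by
    intro a b hab
    rcases lt_trichotomy a b with h | h | h
    · exact absurd (hjmem a b h) (hab ▸ hj b (s b))
    · exact h
    · exact absurd (hjmem b a h) (hab ▸ hj a (s a))
  have hfY : ∀ i n, i < n → f (Y i) (jj n) = 0 := by
    intro i n h
    by_contra hne
    refine hj n (s n) (hSmono (i + 1) n h ?_)
    rw [hs]
    simp only [step, Finset.mem_union]
    right
    exact DFinsupp.mem_support_iff.2 hne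
  -- The infinite sum of the `Y i`: it is finite in each coordinate `k` because `X i` vanishes below
  -- `i`.
  let z : ℕ → ι → ℤ := fun k => ∑ i ∈ Finset.range (k + 1), Y i k
  have hz : ∀ n, f z (jj n) ≠ 0 := by
    intro n h0
    -- The tail of `z` beyond `n`, divided by `N (n + 1)`. At the index `jj n` the earlier terms
    -- contribute zero, so `f z (jj n) = 0` would make `f (Y n) (jj n)` divisible by the forbidden
    -- `M`.
    let w : ℕ → ι → ℤ := fun k =>
      ∑ i ∈ Finset.Ico (n + 1) (k + 1), (N i / N (n + 1)) • X i k
    have hzw : z = (∑ i ∈ Finset.range n, Y i) + Y n + N (n + 1) • w := by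
      funext k
      have h1 : N (n + 1) • w k = ∑ i ∈ Finset.Ico (n + 1) (k + 1), Y i k := by
        simp only [w, Finset.smul_sum]
        refine Finset.sum_congr rfl fun i hi => ?_
        rw [Finset.mem_Ico] at hi
        rw [smul_smul, Nat.mul_div_cancel' (hNdvd _ _ hi.1)]
        rfl
      simp only [Pi.add_apply, Finset.sum_apply, Pi.smul_apply] at h1 ⊢
      rw [h1, ← Finset.sum_range_succ (fun i => Y i k)]
      simp only [z]
      rcases le_total n k with h | h
      · rw [Finset.sum_range_add_sum_Ico _ (by omega)]
      · rw [Finset.Ico_eq_empty (by omega), Finset.sum_empty, add_zero]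
        refine Finset.sum_subset (Finset.range_mono (by omega)) fun i _ hi => ?_
        rw [Finset.mem_range] at hi
        simp [Y, hXz i k (by omega)]
    have h2 : f z (jj n) = f (Y n) (jj n) + N (n + 1) • f w (jj n) := by
      rw [hzw, map_add, map_add, map_sum, DirectSum.add_apply, DirectSum.add_apply,
        DirectSum.sum_apply, Finset.sum_eq_zero fun i hi => hfY i n (Finset.mem_range.1 hi),
        zero_add, map_nsmul f (N (n + 1)) w]
      rfl
    refine hM n (s n) (N n • -(f w (jj n))) ?_
    rw [smul_smul, mul_comm, ← hNsucc, smul_neg]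
    exact eq_neg_of_add_eq_zero_left (h2.symm.trans h0)
  have hfin : (Set.range jj).Finite :=
    (f z).support.finite_toSet.subset (by
      rintro _ ⟨n, rfl⟩
      exact DFinsupp.mem_support_iff.2 (hz n))
  exact Set.infinite_range_of_injective hjinj hfin

lemma card_pi_lt_of_finite {κ : Cardinal.{u}} (hκ : Cardinal.aleph0 ≤ κ) {S : Type u} [Finite S]
    (C : S → Type u) (hC : ∀ j, Cardinal.mk (C j) < κ) : Cardinal.mk (∀ j, C j) < κ := by
  have := Fintype.ofFinite S
  rw [Cardinal.mk_pi, Cardinal.prod_eq_of_fintype, Cardinal.lift_id]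
  exact Finset.prod_induction _ (· < κ) (fun a b ha hb => Cardinal.mul_lt_of_lt hκ ha hb)
    (Cardinal.one_lt_aleph0.trans_le hκ) fun i _ => hC i

/-- For an infinite set `ι`, the group `ℤ^(ℕ × ι)` is not a retract of a direct sum of groups of
cardinality less than that of `ι`. -/
lemma not_retract_directSum {ι : Type u} [Infinite ι] {J : Type u} {C : J → Type u}
    [∀ j, AddCommGroup (C j)] (hC : ∀ j, Cardinal.mk (C j) < Cardinal.mk ι)
    (f : (ℕ → ι → ℤ) →+ ⨁ j, C j) (r : (⨁ j, C j) →+ (ℕ → ι → ℤ)) (h : ∀ x, r (f x) = x) :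
    False := by
  classical
  obtain ⟨m, N, S, hN, hdiv⟩ := exists_eventually_divisible f
  -- Outside `S` the components of `f (N • x)` are divisible by every positive integer, and `r`
  -- sends such elements to zero since a nonzero integer `a` is not divisible by `|a| + 1`. So `N •
  -- x` is determined by finitely many components.
  have key : ∀ x : ℕ → ι → ℤ, (∀ k < m, x k = 0) →
      N • x = ∑ j : S, r (DirectSum.of C j (f (N • x) j)) := by
    intro x hx
    have h0 : ∀ j ∉ S, r (DirectSum.of C j (f (N • x) j)) = 0 := by
      intro j hj
      funext k i
      have hd : ∀ M : ℕ, 0 < M → (M : ℤ) ∣ r (DirectSum.of C j (f (N • x) j)) k i := by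
        intro M hM
        obtain ⟨y, hy⟩ := hdiv x hx j hj M hM
        rw [hy, map_nsmul, map_nsmul]
        exact ⟨r (DirectSum.of C j y) k i, by simp⟩
      by_contra hne
      have := Int.le_of_dvd (abs_pos.2 hne) ((dvd_abs _ _).2
        (hd ((r (DirectSum.of C j (f (N • x) j)) k i).natAbs + 1) (by omega)))
      rw [Int.abs_eq_natAbs] at this
      push_cast at this
      omega
    conv_lhs => rw [← h (N • x), ← DirectSum.sum_support_of (f (N • x)), map_sum]
    rw [Finset.sum_coe_sort S (fun j => r (DirectSum.of C j (f (N • x) j)))]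
    refine (Finset.sum_subset (Finset.subset_union_left (s₂ := S)) fun j _ hj => ?_).trans
      (Finset.sum_subset Finset.subset_union_right fun j _ hj => h0 j hj).symm
    rw [DFinsupp.notMem_support_iff] at hj
    rw [show f (N • x) j = 0 from hj, map_zero, map_zero]
  -- As many elements as `ι` has, all supported in coordinate `m`; their multiples by `N` would be
  -- separated by a product of finitely many groups smaller than `ι`.
  let e : ι → ℕ → ι → ℤ := fun i => Pi.single m (Pi.single i 1)
  have hinj : Function.Injective (fun (i : ι) (j : S) => f (N • e i) j) := by
    intro i i' hii
    have he : N • e i = N • e i' := by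
      rw [key (e i) fun k hk => by simp [e, hk.ne], key (e i') fun k hk => by simp [e, hk.ne]]
      exact Finset.sum_congr rfl fun j _ => by rw [show f (N • e i) j = _ from congrFun hii j]
    have h1 := congrFun (congrFun he m) i
    by_contra hne
    simp [e, Pi.single_eq_of_ne hne] at h1
    omega
  exact absurd (Cardinal.mk_le_of_injective hinj)
    (not_le.2 (card_pi_lt_of_finite (Cardinal.infinite_iff.1 ‹_›) _ fun j => hC j))

lemma not_abLT_intPower (κ : RegularCardinal.{u}) : ¬ AbLT κ.1 (intPower κ.1) := by
  intro hA
  obtain ⟨J, C, hC, f, r, h⟩ := hA.exists_retract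
  have hκ := κ.2.aleph0_le
  have : Infinite κ.1.out := Cardinal.infinite_iff.2 (by simpa using hκ)
  -- Since ℵ₀ · κ = κ, the group ℤ^κ is also ℤ^(ℕ × κ), which provides the coordinate ℕ for the
  -- diagonal argument.
  obtain ⟨e⟩ : Nonempty (κ.1.out ≃ ℕ × κ.1.out) :=
    Cardinal.eq.1 (by
      simp only [Cardinal.mk_prod, Cardinal.mk_out, Cardinal.mk_nat,
        Cardinal.lift_aleph0, Cardinal.lift_uzero]
      exact (Cardinal.aleph0_mul_eq hκ).symm)
  let φ : (ℕ → κ.1.out → ℤ) ≃+ (κ.1.out → ℤ) :=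
    { toFun := fun g k => g (e k).1 (e k).2
      invFun := fun g n k => g (e.symm (n, k))
      left_inv := fun g => by funext n k; simp
      right_inv := fun g => by funext k; simp
      map_add' := fun _ _ => rfl }
  exact not_retract_directSum (C := fun j => (C j : Type u)) (fun j => by simpa using hC j)
    (f.comp φ.toAddMonoidHom) (φ.symm.toAddMonoidHom.comp r) fun x => by
      exact (congrArg φ.symm (h (φ x))).trans (φ.symm_apply_apply x)

/-! ### Existence of precovers -/

/-- A family of maps `φ i : G i ⟶ A` from groups of cardinality `< κ` through which all such maps
factor yields a precover. -/
lemma nonempty_precover_of_family {κ : Cardinal.{u}} {A : AddCommGrpCat.{u}} {I : Type u}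
    (G : I → AddCommGrpCat.{u}) (hG : ∀ i, Cardinal.mk (G i) < κ) (φ : ∀ i, G i ⟶ A)
    (hφ : ∀ (X : AddCommGrpCat.{u}), Cardinal.mk X < κ → ∀ g : X ⟶ A,
      ∃ (i : I) (h : X ⟶ G i), h ≫ φ i = g) :
    Nonempty (Precover κ A) := by
  classical
  refine ⟨⟨AddCommGrpCat.of (⨁ i, G i), .directSum I G fun i => .of_card_lt _ (hG i),
    AddCommGrpCat.ofHom (DirectSum.toAddMonoid fun i => (φ i).hom), fun X hX => ?_⟩⟩
  induction hX with
  | of_card_lt X hX =>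
    intro g
    obtain ⟨i, h, hh⟩ := hφ X hX g
    refine ⟨h ≫ AddCommGrpCat.ofHom (DirectSum.of (fun i => (G i : Type u)) i), ?_⟩
    ext x
    refine Eq.trans ?_ (ConcreteCategory.congr_hom hh x)
    exact DirectSum.toAddMonoid_of (fun i => (φ i).hom) i (h x)
  | directSum ι H _ ih =>
    intro g
    choose h hh using fun i => ih i
      (AddCommGrpCat.ofHom (g.hom.comp (DirectSum.of (fun i => (H i : Type u)) i)))
    refine ⟨AddCommGrpCat.ofHom (DirectSum.toAddMonoid fun i => (h i).hom), ?_⟩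
    ext1
    refine DirectSum.addHom_ext fun i y => ?_
    refine Eq.trans ?_ (ConcreteCategory.congr_hom (hh i) y)
    exact congrArg (DirectSum.toAddMonoid fun i => (φ i).hom)
      (DirectSum.toAddMonoid_of (fun i => (h i).hom) i y)
  | directSummand X B s _ ih =>
    intro g
    obtain ⟨h, hh⟩ := ih (s.r ≫ g)
    exact ⟨s.i ≫ h, by rw [Category.assoc, hh, s.retract_assoc]⟩

/-- Every abelian group has an `AbLT κ`-precover. -/
lemma nonempty_precover (κ : Cardinal.{u}) (A : AddCommGrpCat.{u}) :
    Nonempty (Precover κ A) := by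
  refine nonempty_precover_of_family
    -- A small set of representatives: all group structures on subsets of `κ.out` of cardinality `<
    -- κ`, with all their homomorphisms to `A`.
    (I := Σ B : {s : Set κ.out // Cardinal.mk s < κ}, Σ _ : AddCommGroup B.1, B.1 →+ A)
    (fun i => @AddCommGrpCat.of i.1.1 i.2.1) (fun i => i.1.2)
    (fun i => @AddCommGrpCat.ofHom i.1.1 A i.2.1 _ i.2.2) fun X hX g => ?_
  obtain ⟨ε⟩ : Nonempty (X ↪ κ.out) := by
    have := hX.le
    rwa [← Cardinal.mk_out κ] at this
  let e := Equiv.ofInjective ε ε.injective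
  let inst : AddCommGroup (Set.range ε) := e.symm.addCommGroup
  let e' : X ≃+ Set.range ε := (e.symm.addEquiv).symm
  refine ⟨⟨⟨Set.range ε, by rwa [Cardinal.mk_range_eq ε ε.injective]⟩, inst,
    g.hom.comp e'.symm.toAddMonoidHom⟩, AddCommGrpCat.ofHom e'.toAddMonoidHom, ?_⟩
  ext x
  exact congrArg g.hom (e'.symm_apply_apply x)

end KAbExample

end
noncomputable section

namespace KAbExample

/-! ### Morphisms into a bounded above complex that is exact relative to the source -/

open CochainComplex HomComplex in
/-- If `Y` is bounded above and all cocycles `X^m ⟶ Y^m` lift along the differential of `Y`, then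
every morphism `X ⟶ Y` is homotopic to zero. -/
lemma nonempty_homotopy_zero {C : Type w} [Category.{v} C] [Preadditive C]
    {X Y : CochainComplex C ℤ} (b : ℤ) (hb : ∀ m, b < m → IsZero (Y.X m))
    (hXY : ∀ (m : ℤ) (g : X.X m ⟶ Y.X m), g ≫ Y.d m (m + 1) = 0 →
      ∃ h : X.X m ⟶ Y.X (m - 1), h ≫ Y.d (m - 1) m = g)
    (f : X ⟶ Y) : Nonempty (Homotopy f 0) := by
  -- Stage `k` satisfies the homotopy identity in all degrees above `b - k`; the zero cochain starts
  -- the induction because `Y` vanishes above `b`.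
  let P : ℕ → Cochain X Y (-1) → Prop := fun k z => ∀ p : ℤ, b - k < p →
    f.f p = z.v p (p - 1) (by lia) ≫ Y.d (p - 1) p + X.d p (p + 1) ≫ z.v (p + 1) p (by lia)
  have h0 : P 0 0 := fun p hp => (hb p (by simpa using hp)).eq_of_tgt _ _
  have hstep : ∀ (k : ℕ) (z : {z // P k z}), ∃ z' : {z // P (k + 1) z},
      ∀ (p q : ℤ) (hpq : p + (-1) = q), b - k < p → z'.1.v p q hpq = z.1.v p q hpq := by
    rintro k ⟨z, hz⟩
    obtain ⟨m, hm⟩ : ∃ m : ℤ, m = b - k := ⟨_, rfl⟩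
    -- The defect of the identity in degree `m` is a cocycle, because the identity already holds in
    -- degree `m + 1`. Adding a lift of it changes only the component out of `X.X m`, so higher
    -- degrees are unaffected.
    obtain ⟨h, hh⟩ := hXY m (f.f m - (z.v m (m - 1) (by lia) ≫ Y.d (m - 1) m +
        X.d m (m + 1) ≫ z.v (m + 1) m (by lia))) (by
      have h1 := hz (m + 1) (by lia)
      have h2 : (z.v (m + 1) (m + 1 - 1) (by lia)) ≫ Y.d (m + 1 - 1) (m + 1) =
          z.v (m + 1) m (by lia) ≫ Y.d m (m + 1) := by
        congr! <;> lia
      rw [h2] at h1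
      simp only [Preadditive.sub_comp, Preadditive.add_comp, Category.assoc,
        HomologicalComplex.d_comp_d, comp_zero, zero_add]
      rw [f.comm, h1, Preadditive.comp_add, HomologicalComplex.d_comp_d_assoc, zero_comp,
        add_zero, sub_self])
    refine ⟨⟨z + Cochain.single h (-1), fun p hp => ?_⟩, fun p q hpq hp => ?_⟩
    · simp only [Cochain.add_v]
      rw [Cochain.single_v_eq_zero h (-1) (p + 1) p (by lia) (by push_cast at hp; lia), add_zero]
      by_cases hpm : p = m
      · subst hpm
        rw [Cochain.single_v, Preadditive.add_comp, hh]
        abel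
      · rw [Cochain.single_v_eq_zero h (-1) p (p - 1) (by lia) hpm, add_zero]
        exact hz p (by push_cast at hp; lia)
    · simp only [Cochain.add_v]
      rw [Cochain.single_v_eq_zero h (-1) p q (by lia) (by lia), add_zero]
  choose φ hφ using hstep
  let s : ∀ k : ℕ, {z // P k z} := fun k => Nat.rec ⟨0, h0⟩ φ k
  have hs : ∀ (k l : ℕ) (p q : ℤ) (hpq : p + (-1) = q), k ≤ l → b - k < p →
      (s l).1.v p q hpq = (s k).1.v p q hpq := by
    intro k l p q hpq hkl hp
    induction l, hkl using Nat.le_induction with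
    | base => rfl
    | succ l hl ih => exact (hφ l (s l) p q hpq (by omega)).trans ih
  -- The component out of degree `p` is frozen from stage `b + 1 - p` on; the limit cochain takes
  -- these stable values.
  let z : Cochain X Y (-1) :=
    Cochain.mk fun p q hpq => (s (b + 1 - p).toNat).1.v p q hpq
  refine ⟨(Cochain.equivHomotopy f 0).symm ⟨z, ?_⟩⟩
  ext p
  rw [Cochain.add_v, δ_v (-1) 0 (by omega) z p p (by omega) (p - 1) (p + 1) rfl rfl]
  simp only [Cochain.ofHom_v, HomologicalComplex.zero_f, add_zero, Int.negOnePow_zero, one_smul]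
  have h1 := (s (b + 1 - p).toNat).2 p (by omega)
  rw [h1, hs (b + 1 - (p + 1)).toNat (b + 1 - p).toNat (p + 1) p (by omega) (by omega) (by omega)]
  rfl

/-! ### The relative resolutions -/

section Resolution

variable {κ : Cardinal.{u}} (c : ℕ → ∀ B : AddCommGrpCat.{u}, Precover κ B)
  (A : AddCommGrpCat.{u})

instance mono_resolutionIncl (n : ℕ) : Mono (resolutionIncl c A n) := by
  cases n with
  | zero => exact inferInstanceAs (Mono (𝟙 A))
  | succ n => exact equalizer.ι_mono (f := (c n (syzygy c A n)).map) (g := 0)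

lemma exists_lift_resolutionCover {X : AddCommGrpCat.{u}} (hX : AbLT κ X) (n : ℕ)
    (g : X ⟶ syzygy c A n) : ∃ h : X ⟶ resolutionX c A (n + 1), h ≫ resolutionCover c A n = g :=
  (c n (syzygy c A n)).exists_lift X hX g

/-- The inclusion of the syzygy is mono, so a cocycle is killed by the precover itself and factors
through the kernel, which is the target of the next precover. -/
lemma exists_lift_resolutionD {X : AddCommGrpCat.{u}} (hX : AbLT κ X) (n : ℕ)
    (g : X ⟶ resolutionX c A (n + 1)) (hg : g ≫ resolutionD c A n = 0) :
    ∃ h : X ⟶ resolutionX c A (n + 2), h ≫ resolutionD c A (n + 1) = g := by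
  have hg' : g ≫ resolutionCover c A n = 0 := by
    rw [← cancel_mono (resolutionIncl c A n), Category.assoc, zero_comp]
    exact hg
  obtain ⟨h, hh⟩ := exists_lift_resolutionCover c A hX (n + 1)
    (kernel.lift (c n (syzygy c A n)).map g hg')
  refine ⟨h, ?_⟩
  rw [resolutionD, ← Category.assoc, hh]
  exact kernel.lift_ι _ _ _

lemma exists_lift_resolutionD_zero {X : AddCommGrpCat.{u}} (hX : AbLT κ X)
    (g : X ⟶ resolutionX c A 0) : ∃ h : X ⟶ resolutionX c A 1, h ≫ resolutionD c A 0 = g := by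
  obtain ⟨h, hh⟩ := exists_lift_resolutionCover c A hX 0 g
  exact ⟨h, by rw [resolutionD, ← Category.assoc, hh]; exact Category.comp_id g⟩

/-- The terms of the resolution in degrees `≤ 1`. -/
def resolutionXIso {m : ℤ} (n : ℕ) (h : 1 - (n : ℤ) = m) :
    (resolution c A).X m ≅ resolutionX c A n :=
  HomologicalComplex.extendXIso _ (ComplexShape.embeddingUpIntLE 1) h

lemma resolution_d_eq {m m' : ℤ} (n : ℕ) (h : 1 - ((n + 1 : ℕ) : ℤ) = m)
    (h' : 1 - (n : ℤ) = m') :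
    (resolution c A).d m m' = (resolutionXIso c A (n + 1) h).hom ≫ resolutionD c A n ≫
      (resolutionXIso c A n h').inv := by
  refine (HomologicalComplex.extend_d_eq _ (ComplexShape.embeddingUpIntLE 1) h h').trans ?_
  have h1 : (ChainComplex.of (resolutionX c A) (resolutionD c A) (resolutionD_comp c A)).d
      (n + 1) n = resolutionD c A n := ChainComplex.of_d _ _ _
  exact congrArg (fun d => (resolutionXIso c A (n + 1) h).hom ≫ d ≫
    (resolutionXIso c A n h').inv) h1

lemma isZero_resolution_X (m : ℤ) (hm : 1 < m) : IsZero ((resolution c A).X m) :=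
  HomologicalComplex.isZero_extend_X _ _ _
    ((ComplexShape.notMem_range_embeddingUpIntLE_iff 1 m).2 hm)

lemma exists_lift_resolution_d {X : AddCommGrpCat.{u}} (hX : AbLT κ X) (m : ℤ)
    (g : X ⟶ (resolution c A).X m) (hg : g ≫ (resolution c A).d m (m + 1) = 0) :
    ∃ h : X ⟶ (resolution c A).X (m - 1), h ≫ (resolution c A).d (m - 1) m = g := by
  by_cases hm : 1 < m
  · exact ⟨0, (isZero_resolution_X c A m hm).eq_of_tgt _ _⟩
  obtain ⟨n, hn⟩ : ∃ n : ℕ, 1 - (n : ℤ) = m := ⟨(1 - m).toNat, by lia⟩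
  obtain ⟨h, hh⟩ : ∃ h : X ⟶ resolutionX c A (n + 1),
      h ≫ resolutionD c A n = g ≫ (resolutionXIso c A n hn).hom := by
    cases n with
    | zero => exact exists_lift_resolutionD_zero c A hX _
    | succ n =>
      refine exists_lift_resolutionD c A hX n _ ?_
      rw [resolution_d_eq c A n hn (by lia)] at hg
      rw [← cancel_mono (resolutionXIso c A n (m := m + 1) (by lia)).inv, Category.assoc,
        Category.assoc, hg, zero_comp]
  refine ⟨h ≫ (resolutionXIso c A (n + 1) (by lia)).inv, ?_⟩
  rw [resolution_d_eq c A n (by lia) hn, Category.assoc, Iso.inv_hom_id_assoc, reassoc_of% hh,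
    Iso.hom_inv_id, Category.comp_id]

/-- A complex with terms in `AbLT κ` has no nonzero morphisms to the resolution in `K(Ab)`. -/
lemma hom_resolution_eq_zero (X : KAb.{u}) (hX : ∀ m, AbLT κ (X.as.X m))
    (f : X ⟶ (HomotopyCategory.quotient AddCommGrpCat.{u} (ComplexShape.up ℤ)).obj
      (resolution c A)) : f = 0 := by
  obtain ⟨X, rfl⟩ := HomotopyCategory.quotient_obj_surjective X
  obtain ⟨f, rfl⟩ := (HomotopyCategory.quotient _ _).map_surjective f
  rw [HomotopyCategory.quotient_map_eq_zero_iff]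
  exact nonempty_homotopy_zero 1 (isZero_resolution_X c A)
    (fun m g hg => exists_lift_resolution_d c A (hX m) m g hg) f

/-- If the resolution of `A` vanishes in `K(Ab)`, then `A` belongs to `AbLT κ`. -/
lemma abLT_of_id_resolution_eq_zero
    (h : 𝟙 ((HomotopyCategory.quotient AddCommGrpCat.{u} (ComplexShape.up ℤ)).obj
      (resolution c A)) = 0) : AbLT κ A := by
  rw [← CategoryTheory.Functor.map_id, HomotopyCategory.quotient_map_eq_zero_iff] at h
  obtain ⟨s⟩ := h
  -- As the complex vanishes in degree 2, the homotopy identity in degree 1 says that the precover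
  -- of `A` splits.
  have h1 := s.comm 1
  rw [dNext_eq s.hom (show (ComplexShape.up ℤ).Rel 1 2 by simp),
    prevD_eq s.hom (show (ComplexShape.up ℤ).Rel 0 1 by simp),
    (isZero_resolution_X c A 2 (by lia)).eq_of_src (s.hom 2 1) 0, comp_zero, zero_add,
    HomologicalComplex.zero_f, add_zero, HomologicalComplex.id_f,
    resolution_d_eq c A 0 (by lia) (by lia)] at h1
  let e := resolutionXIso c A 0 (m := 1) (by lia)
  refine .directSummand A _ ⟨e.inv ≫ s.hom 1 0 ≫ (resolutionXIso c A 1 (by lia)).hom,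
    resolutionD c A 0, ?_⟩ (c 0 (syzygy c A 0)).mem
  have h2 := e.inv ≫= h1 =≫ e.hom
  simp only [Category.assoc, Category.id_comp, Iso.inv_hom_id, e] at h2 ⊢
  rw [Category.comp_id] at h2
  exact h2.symm

end Resolution

/-- For every complex `X`, the terms of `X` belong to `AbLT κ` for all large `κ`. -/
lemma exists_forall_abLT (X : KAb.{u}) :
    ∃ μ : Cardinal.{u}, ∀ κ, μ < κ → ∀ m, AbLT κ (X.as.X m) := by
  refine ⟨⨆ m : ULift.{u} ℤ, Cardinal.mk (X.as.X m.down), fun κ hκ m => .of_card_lt _ ?_⟩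
  exact (le_ciSup (f := fun m : ULift.{u} ℤ => Cardinal.mk (X.as.X m.down))
    Cardinal.bddAbove_of_small ⟨m⟩).trans_lt hκ

/-! ### Smallness of the product, and the obstruction to retracts -/

section ClassProduct

variable (c : ∀ κ : RegularCardinal.{u}, ℕ → ∀ B : AddCommGrpCat.{u}, Precover κ.1 B)

lemma exists_hom_resolutionIntPower_eq_zero (X : KAb.{u}) :
    ∃ μ : Cardinal.{u}, ∀ κ : RegularCardinal.{u}, μ < κ.1 →
      ∀ f : X ⟶ resolutionIntPower c κ, f = 0 := by
  obtain ⟨μ, hμ⟩ := exists_forall_abLT X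
  exact ⟨μ, fun κ hκ f => hom_resolution_eq_zero _ _ X (hμ κ.1 hκ) f⟩

/-- Only the factors with `κ ≤ μ` can be nonzero, and these are indexed by a small set. -/
instance small_classProduct_obj (X : KAb.{u}ᵒᵖ) :
    Small.{u} ((classProduct (resolutionIntPower c)).obj X) := by
  obtain ⟨μ, hμ⟩ := exists_hom_resolutionIntPower_eq_zero c X.unop
  have : Small.{u} {κ : RegularCardinal.{u} // κ.1 ≤ μ} :=
    small_of_injective (β := Set.Iic μ) (f := fun κ => ⟨κ.1.1, κ.2⟩) fun a b h =>
      Subtype.ext (Subtype.ext (congrArg (fun x : Set.Iic μ => x.1) h))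
  refine small_of_injective
    (β := ∀ κ : {κ : RegularCardinal.{u} // κ.1 ≤ μ}, X.unop ⟶ resolutionIntPower c κ.1)
    (f := fun g κ => g κ.1) fun g gg h => ?_
  funext κ
  by_cases hκ : κ.1 ≤ μ
  · exact congrFun h ⟨κ, hκ⟩
  · rw [hμ κ (not_le.1 hκ) (g κ), hμ κ (not_le.1 hκ) (gg κ)]

/-- No complex has all the complexes `Y_{ℤ^κ, κ}` as retracts. -/
lemma exists_resolutionIntPower_not_retract (Z : KAb.{u}) :
    ∃ κ : RegularCardinal.{u}, ∀ (i : resolutionIntPower c κ ⟶ Z)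
      (r : Z ⟶ resolutionIntPower c κ), i ≫ r ≠ 𝟙 _ := by
  obtain ⟨μ, hμ⟩ := exists_hom_resolutionIntPower_eq_zero c Z
  -- A successor of an infinite cardinal is regular; this one also exceeds `μ`, so every map from
  -- `Z` to the resolution is zero.
  let κ : RegularCardinal.{u} :=
    ⟨Order.succ (max Cardinal.aleph0 μ), Cardinal.isRegular_succ (le_max_left _ _)⟩
  refine ⟨κ, fun i r h => not_abLT_intPower κ (abLT_of_id_resolution_eq_zero (c κ) _ ?_)⟩
  rw [hμ κ ((le_max_right _ _).trans_lt (Order.lt_succ _)) r, comp_zero] at h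
  exact h.symm

end ClassProduct

end KAbExample

end
noncomputable section

namespace KAbExample

/-! ### Coproducts in the homotopy category -/

section Coproducts

variable {V : Type w} [Category.{v} V] [Preadditive V] {ι : Type*} {c : ComplexShape ι}

/-- A morphism from a coproduct which is degreewise a coproduct is homotopic to zero if all of its
components are. -/
def homotopyZeroOfCofan {J : Type u} {X : J → HomologicalComplex V c} (t : Cofan X)
    (ht : ∀ i, IsColimit ((HomologicalComplex.eval V c i).mapCocone t))
    {Z : HomologicalComplex V c} (f : t.pt ⟶ Z) (h : ∀ j, Homotopy (t.inj j ≫ f) 0) :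
    Homotopy f 0 :=
  have ext' : ∀ (i : ι) {W : V} (a b : t.pt.X i ⟶ W)
      (_ : ∀ j, (t.inj j).f i ≫ a = (t.inj j).f i ≫ b), a = b := fun i W a b hab =>
    (ht i).hom_ext fun ⟨j⟩ => hab j
  let s : ∀ i k, t.pt.X i ⟶ Z.X k := fun i k =>
    (ht i).desc ⟨Z.X k, Discrete.natTrans fun ⟨j⟩ => (h j).hom i k⟩
  have fac : ∀ i k j, (t.inj j).f i ≫ s i k = (h j).hom i k := fun i k j =>
    (ht i).fac ⟨Z.X k, Discrete.natTrans fun ⟨j⟩ => (h j).hom i k⟩ ⟨j⟩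
  { hom := s
    zero := fun i k hik => ext' i _ _ fun j => by rw [fac, (h j).zero i k hik, comp_zero]
    comm := fun i => ext' i _ _ fun j => by
      have h1 := (h j).comm i
      have h2 : (h j).hom = fun i k => (t.inj j).f i ≫ s i k := by
        funext i k
        exact (fac i k j).symm
      rw [h2, dNext_comp_left, prevD_comp_left] at h1
      simpa only [Preadditive.comp_add, HomologicalComplex.zero_f, comp_zero,
        HomologicalComplex.comp_f] using h1 }

/-- The coproduct of complexes still works up to homotopy: existence follows by choosing
representatives, uniqueness by assembling null-homotopies of the components. -/
lemma hasCoproducts_homotopyCategory [HasCoproducts.{u} V] :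
    HasCoproducts.{u} (HomotopyCategory V c) := by
  intro J
  suffices h : ∀ X : J → HomotopyCategory V c, HasColimit (Discrete.functor X) from
    ⟨fun K => have := h (K.obj ∘ Discrete.mk); hasColimit_of_iso Discrete.natIsoFunctor⟩
  intro X
  let X' : J → HomologicalComplex V c := fun j => (X j).as
  let t : Cofan X' := Cofan.mk (∐ X') (Sigma.ι X')
  have ht : IsColimit t := coproductIsCoproduct X'
  let q := HomotopyCategory.quotient V c
  let t' : Cofan X := Cofan.mk (q.obj t.pt) fun j => q.map (t.inj j)
  have hex : ∀ s : Cofan X, ∃ m : t'.pt ⟶ s.pt, ∀ j, t'.inj j ≫ m = s.inj j := by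
    intro s
    let g : ∀ j, X' j ⟶ s.pt.as := fun j => (s.inj j).out
    refine ⟨q.map (Cofan.IsColimit.desc ht g), fun j => ?_⟩
    change q.map (t.inj j) ≫ q.map _ = _
    rw [← q.map_comp, Cofan.IsColimit.fac]
    exact HomotopyCategory.quotient_map_out (s.inj j)
  have huniq : ∀ {S : HomotopyCategory V c} (m : t'.pt ⟶ S),
      (∀ j, t'.inj j ≫ m = 0) → m = 0 := by
    intro S m hm
    obtain ⟨S, rfl⟩ := HomotopyCategory.quotient_obj_surjective S
    obtain ⟨m, rfl⟩ := q.map_surjective m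
    have hm' : ∀ j, Nonempty (Homotopy (t.inj j ≫ m) 0) := fun j => by
      rw [← HomotopyCategory.quotient_map_eq_zero_iff, Functor.map_comp]
      exact hm j
    exact (HomotopyCategory.quotient_map_eq_zero_iff m).2
      ⟨homotopyZeroOfCofan t (fun i => isColimitOfPreserves _ ht) m fun j => (hm' j).some⟩
  refine ⟨⟨⟨t', Cofan.IsColimit.mk t' (fun s => (hex s).choose) (fun s => (hex s).choose_spec)
    fun s m hm => ?_⟩⟩⟩
  rw [← sub_eq_zero]
  refine huniq _ fun j => ?_
  rw [Preadditive.comp_sub, hm, (hex s).choose_spec, sub_self]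

end Coproducts

lemma hasCoproducts_KAb : HasCoproducts.{u} KAb.{u} :=
  hasCoproducts_homotopyCategory

end KAbExample

end
noncomputable section

namespace KAbExample

/-! ### Elements of modules -/

section Elements

variable {T : Type w} [Category.{v} T] [Preadditive T]

/-- The value of a morphism `T(-, x) ⟶ X` at an element `s : t ⟶ x`. -/
def evalHom {x : T} {X : Tᵒᵖ ⥤ AddCommGrpCat.{v}} (p : preadditiveYoneda.obj x ⟶ X) {t : T}
    (s : t ⟶ x) : X.obj (op t) :=
  (p.app (op t)).hom s

variable {x y : T} {X Y : Tᵒᵖ ⥤ AddCommGrpCat.{v}} (p : preadditiveYoneda.obj x ⟶ X)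

lemma evalHom_add {t : T} (s s' : t ⟶ x) : evalHom p (s + s') = evalHom p s + evalHom p s' :=
  (p.app (op t)).hom.map_add s s'

lemma evalHom_sub {t : T} (s s' : t ⟶ x) : evalHom p (s - s') = evalHom p s - evalHom p s' :=
  (p.app (op t)).hom.map_sub s s'

lemma evalHom_zero {t : T} : evalHom p (0 : t ⟶ x) = 0 :=
  (p.app (op t)).hom.map_zero

lemma map_evalHom {t t' : T} (k : t' ⟶ t) (s : t ⟶ x) :
    (X.map k.op).hom (evalHom p s) = evalHom p (k ≫ s) :=
  (ConcreteCategory.congr_hom (p.naturality k.op) s).symm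

lemma evalHom_eq_map {t : T} (s : t ⟶ x) : evalHom p s = (X.map s.op).hom (evalHom p (𝟙 x)) := by
  rw [map_evalHom, Category.comp_id]

lemma evalHom_comp (q : X ⟶ Y) {t : T} (s : t ⟶ x) :
    evalHom (p ≫ q) s = (q.app (op t)).hom (evalHom p s) := rfl

lemma evalHom_map_comp (g : y ⟶ x) {t : T} (s : t ⟶ y) :
    evalHom (preadditiveYoneda.map g ≫ p) s = evalHom p (s ≫ g) := rfl

variable {p} in
lemma evalHom_ext {q : preadditiveYoneda.obj x ⟶ X} (h : evalHom p (𝟙 x) = evalHom q (𝟙 x)) :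
    p = q := by
  have heval : ∀ {t : T} (s : t ⟶ x), evalHom p s = evalHom q s := fun s => by
    rw [evalHom_eq_map, h, ← evalHom_eq_map]
  ext t s
  exact heval s

/-- The morphism `T(-, x) ⟶ X` given by an element of `X(x)`, for an additive functor `X`. -/
def homOfElement [X.Additive] (ξ : X.obj (op x)) : preadditiveYoneda.obj x ⟶ X :=
  have h0 : ∀ t : T, (X.map (0 : t ⟶ x).op).hom ξ = 0 := fun t => by
    rw [op_zero, Functor.map_zero]; rfl
  have hadd : ∀ {t : T} (s s' : t ⟶ x), (X.map (s + s').op).hom ξ =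
      (X.map s.op).hom ξ + (X.map s'.op).hom ξ := fun s s' => by
    rw [op_add, Functor.map_add]; rfl
  have hcomp : ∀ {t t' : T} (k : t' ⟶ t) (s : t ⟶ x), (X.map (k ≫ s).op).hom ξ =
      (X.map k.op).hom ((X.map s.op).hom ξ) := fun k s => by
    rw [op_comp, Functor.map_comp]; rfl
  { app := fun t => AddCommGrpCat.ofHom
      { toFun := fun s : t.unop ⟶ x => (X.map s.op).hom ξ
        map_zero' := h0 t.unop
        map_add' := hadd }
    naturality := fun t t' k => by
      ext s
      exact hcomp k.unop s }

lemma evalHom_homOfElement [X.Additive] (ξ : X.obj (op x)) {t : T} (s : t ⟶ x) :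
    evalHom (homOfElement ξ) s = (X.map s.op).hom ξ := rfl

lemma evalHom_homOfElement_id [X.Additive] (ξ : X.obj (op x)) :
    evalHom (homOfElement ξ) (𝟙 x) = ξ := by
  rw [evalHom_homOfElement, op_id, CategoryTheory.Functor.map_id]
  rfl

end Elements

/-! ### Exactness in functor categories -/

section FunctorCategory

variable {T : Type w} [Category.{v} T] {X Y : Tᵒᵖ ⥤ AddCommGrpCat.{v}}

lemma naturality_apply (q : X ⟶ Y) {t t' : T} (k : t' ⟶ t) (a : X.obj (op t)) :
    (q.app (op t')).hom ((X.map k.op).hom a) = (Y.map k.op).hom ((q.app (op t)).hom a) :=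
  ConcreteCategory.congr_hom (q.naturality k.op) a

/-- Evaluation functors commute with homology, and a functor is zero if its values are. -/
lemma exact_of_evaluation {C : Type*} [Category* C] {D : Type*} [Category* D] [Abelian D]
    (S : ShortComplex (C ⥤ D)) (h : ∀ t, (S.map ((evaluation C D).obj t)).Exact) : S.Exact := by
  rw [ShortComplex.exact_iff_isZero_homology]
  refine Functor.isZero _ fun t => ?_
  exact ((ShortComplex.exact_iff_isZero_homology _).1 (h t)).of_iso
    (S.mapHomologyIso ((evaluation C D).obj t)).symm

lemma exact_iff_elements (S : ShortComplex (Tᵒᵖ ⥤ AddCommGrpCat.{v})) :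
    S.Exact ↔ ∀ (t : T) (a : S.X₂.obj (op t)), (S.g.app (op t)).hom a = 0 →
      ∃ b : S.X₁.obj (op t), (S.f.app (op t)).hom b = a := by
  constructor
  · intro h t
    exact (ShortComplex.ab_exact_iff _).1 (h.map ((evaluation Tᵒᵖ AddCommGrpCat.{v}).obj (op t)))
  · intro h
    refine exact_of_evaluation S fun t => ?_
    rw [ShortComplex.ab_exact_iff]
    exact h t.unop

lemma epi_iff_elements (q : X ⟶ Y) :
    Epi q ↔ ∀ (t : T), Function.Surjective (q.app (op t)).hom := by
  rw [NatTrans.epi_iff_epi_app]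
  constructor
  · intro h t
    exact (AddCommGrpCat.epi_iff_surjective _).1 (h (op t))
  · intro h t
    exact (AddCommGrpCat.epi_iff_surjective _).2 (h t.unop)

lemma mono_iff_elements (q : X ⟶ Y) :
    Mono q ↔ ∀ (t : T), Function.Injective (q.app (op t)).hom := by
  rw [NatTrans.mono_iff_mono_app]
  constructor
  · intro h t
    exact (AddCommGrpCat.mono_iff_injective _).1 (h (op t))
  · intro h t
    exact (AddCommGrpCat.mono_iff_injective _).2 (h t.unop)

end FunctorCategory

/-! ### Presentations -/

section Presentations

variable {T : Type w} [Category.{v} T] [Preadditive T]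

/-- A presentation `T(-, y) ⟶ T(-, x) ⟶ X ⟶ 0` in terms of elements. -/
structure Presentation (X : Tᵒᵖ ⥤ AddCommGrpCat.{v}) where
  /-- the generating object -/
  x : T
  /-- the object of relations -/
  y : T
  /-- the relations -/
  g : y ⟶ x
  /-- the generators -/
  p : preadditiveYoneda.obj x ⟶ X
  exists_eq : ∀ {t : T} (a : X.obj (op t)), ∃ s : t ⟶ x, evalHom p s = a
  eq_zero_iff : ∀ {t : T} (s : t ⟶ x), evalHom p s = 0 ↔ ∃ k : t ⟶ y, k ≫ g = s

namespace Presentation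

variable {X : Tᵒᵖ ⥤ AddCommGrpCat.{v}} (P : Presentation X)

lemma map_comp_p : preadditiveYoneda.map P.g ≫ P.p = 0 :=
  evalHom_ext ((P.eq_zero_iff _).2 ⟨𝟙 _, rfl⟩)

lemma exact : (ShortComplex.mk _ _ P.map_comp_p).Exact :=
  (exact_iff_elements _).2 fun _ s hs => (P.eq_zero_iff s).1 hs

instance epi_p : Epi P.p := (epi_iff_elements _).2 fun _ a => P.exists_eq a

lemma additive (P : Presentation X) : X.Additive where
  map_add {t t' f f'} := by
    ext a
    obtain ⟨s, rfl⟩ := P.exists_eq a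
    change (X.map (f.unop + f'.unop).op).hom (evalHom P.p s) =
      (X.map f.unop.op).hom (evalHom P.p s) + (X.map f'.unop.op).hom (evalHom P.p s)
    simp only [map_evalHom, Preadditive.add_comp, evalHom_add]

lemma map_g_generator : (X.map P.g.op).hom (evalHom P.p (𝟙 P.x)) = 0 := by
  rw [map_evalHom, Category.comp_id, P.eq_zero_iff]
  exact ⟨𝟙 _, Category.id_comp _⟩

lemma hom_ext {G : Tᵒᵖ ⥤ AddCommGrpCat.{v}} {a b : X ⟶ G}
    (h : (a.app (op P.x)).hom (evalHom P.p (𝟙 P.x)) =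
      (b.app (op P.x)).hom (evalHom P.p (𝟙 P.x))) : a = b := by
  rw [← cancel_epi P.p]
  exact evalHom_ext h

/-- A morphism `X ⟶ G` is given by an element of `G(x)` that is killed by the relations. -/
lemma exists_desc {G : Tᵒᵖ ⥤ AddCommGrpCat.{v}} [G.Additive] (γ : G.obj (op P.x))
    (hγ : (G.map P.g.op).hom γ = 0) :
    ∃ η : X ⟶ G, (η.app (op P.x)).hom (evalHom P.p (𝟙 P.x)) = γ := by
  have h0 : preadditiveYoneda.map P.g ≫ homOfElement γ = 0 := evalHom_ext (by
    rw [evalHom_map_comp, Category.id_comp, evalHom_homOfElement, hγ]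
    rfl)
  have : Epi (ShortComplex.mk _ _ P.map_comp_p).g := P.epi_p
  refine ⟨P.exact.desc (homOfElement γ) h0, ?_⟩
  rw [← evalHom_comp]
  exact (congrArg (fun q => evalHom q (𝟙 P.x)) (P.exact.g_desc (homOfElement γ) h0)).trans
    (evalHom_homOfElement_id γ)

/-- The presentation of the cokernel of `T(-, y) ⟶ T(-, x)`. -/
def ofHom {x y : T} (g : y ⟶ x) : Presentation (cokernel (preadditiveYoneda.map g)) where
  x := x
  y := y
  g := g
  p := cokernel.π _
  exists_eq := (epi_iff_elements (cokernel.π (preadditiveYoneda.map g))).1 inferInstance _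
  eq_zero_iff {t} s := by
    constructor
    · exact (exact_iff_elements (ShortComplex.mk _ _ (cokernel.condition _))).1
        (ShortComplex.exact_cokernel (preadditiveYoneda.map g)) t s
    · rintro ⟨k, rfl⟩
      rw [← evalHom_map_comp, cokernel.condition]
      rfl

/-- Presentations are transported along isomorphisms. -/
def ofIso {Y : Tᵒᵖ ⥤ AddCommGrpCat.{v}} (e : X ≅ Y) : Presentation Y where
  x := P.x
  y := P.y
  g := P.g
  p := P.p ≫ e.hom
  exists_eq {t} a := (epi_iff_elements (P.p ≫ e.hom)).1 inferInstance t a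
  eq_zero_iff {t} s := by
    rw [← P.eq_zero_iff, evalHom_comp]
    exact map_eq_zero_iff (e.hom.app (op t)).hom ((mono_iff_elements e.hom).1 inferInstance t)

/-- The presentation of a representable functor. -/
def yoneda (x : T) : Presentation (preadditiveYoneda.obj x) where
  x := x
  y := x
  g := 0
  p := 𝟙 _
  exists_eq a := ⟨a, rfl⟩
  eq_zero_iff {t} s := ⟨fun h => ⟨0, by rw [comp_zero]; exact h.symm⟩, fun ⟨k, hk⟩ => by
    rw [← hk, comp_zero, evalHom_zero]⟩

end Presentation

lemma finitelyPresentable_iff (X : Tᵒᵖ ⥤ AddCommGrpCat.{v}) :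
    finitelyPresentable T X ↔ Nonempty (Presentation X) := by
  constructor
  · rintro ⟨x, y, f, p, hfp, hex, hp⟩
    obtain ⟨g, rfl⟩ := preadditiveYoneda.map_surjective f
    refine ⟨⟨x, y, g, p, fun {t} a => (epi_iff_elements p).1 hp t a, fun {t} s => ?_⟩⟩
    refine ⟨fun h => (exact_iff_elements _).1 hex t s h, ?_⟩
    rintro ⟨k, rfl⟩
    rw [← evalHom_map_comp, hfp]
    rfl
  · rintro ⟨P⟩
    exact ⟨P.x, P.y, preadditiveYoneda.map P.g, P.p, P.map_comp_p, P.exact, P.epi_p⟩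

/-- A chosen presentation of an object of `A(T)`. -/
def presentation (X : Abelianization T) : Presentation X.obj :=
  ((finitelyPresentable_iff X.obj).1 X.property).some

instance additive_obj (X : Abelianization T) : X.obj.Additive := (presentation X).additive

instance : (finitelyPresentable T).IsClosedUnderIsomorphisms where
  of_iso e h := by
    rw [finitelyPresentable_iff] at h ⊢
    exact ⟨h.some.ofIso e⟩

/-- Natural transformations from a finitely presentable module to a module with values in
`AddCommGrpCat.{v}` form a small set. -/
lemma Presentation.small_hom {X : Tᵒᵖ ⥤ AddCommGrpCat.{v}} (P : Presentation X)
    (G : Tᵒᵖ ⥤ AddCommGrpCat.{v}) : Small.{v} (X ⟶ G) :=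
  small_of_injective (β := G.obj (op P.x))
    (f := fun a => (a.app (op P.x)).hom (evalHom P.p (𝟙 P.x))) fun _ _ h => P.hom_ext h

lemma locallySmall_abelianization : LocallySmall.{v} (Abelianization T) where
  hom_small X Y := by
    have := (presentation X).small_hom Y.obj
    exact small_of_injective (β := X.obj ⟶ Y.obj) (f := fun f => f.hom)
      fun _ _ h => ObjectProperty.hom_ext _ h

end Presentations

end KAbExample

end
noncomputable section

namespace KAbExample

section Triangulated

variable {T : Type w} [Category.{v} T] [Preadditive T] [HasZeroObject T] [HasShift T ℤ]
  [∀ n : ℤ, (shiftFunctor T n).Additive] [Pretriangulated T]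

open Pretriangulated ZeroObject

/-! ### The abelianization of a triangulated category is abelian -/

/-- Weak pullbacks, together with the exactness property of homological functors on them. -/
lemma exists_weakPullback {a d c : T} (v : a ⟶ c) (g : d ⟶ c) :
    ∃ (e : T) (i : e ⟶ a) (j : e ⟶ d), i ≫ v = j ≫ g ∧
      (∀ {t : T} (s : t ⟶ a) (l : t ⟶ d), s ≫ v = l ≫ g → ∃ k : t ⟶ e, k ≫ i = s) ∧
      ∀ (F : Tᵒᵖ ⥤ AddCommGrpCat.{v}) [F.IsHomological] (φ : F.obj (op a)),
        (F.map i.op).hom φ = 0 →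
        ∃ ψ : F.obj (op c), (F.map v.op).hom ψ = φ ∧ (F.map g.op).hom ψ = 0 := by
  -- The weak pullback is the fibre of `(v, -g) : a ⊞ d ⟶ c`.
  obtain ⟨e, f, h, mem⟩ := distinguished_cocone_triangle₁ (biprod.desc v (-g))
  have hf : f ≫ biprod.desc v (-g) = 0 := comp_distTriang_mor_zero₁₂ _ mem
  refine ⟨e, f ≫ biprod.fst, f ≫ biprod.snd, ?_, fun s l hsl => ?_, fun F _ φ hφ => ?_⟩
  · rw [biprod.desc_eq, Preadditive.comp_add] at hf
    simpa [add_neg_eq_zero] using hf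
  · obtain ⟨k, hk⟩ : ∃ k, biprod.lift s l = k ≫ f :=
      Triangle.coyoneda_exact₂ _ mem (biprod.lift s l) (by
        change biprod.lift s l ≫ biprod.desc v (-g) = 0
        simp [hsl])
    exact ⟨k, by rw [← Category.assoc, ← hk, biprod.lift_fst]⟩
  -- The element `(φ, 0)` of `F(a ⊞ d)` restricts to `F(i) φ = 0` on the fibre, so exactness of `F`
  -- on the triangle extends it to `c`.
  · obtain ⟨ψ, hψ⟩ : ∃ ψ : F.obj (op c),
        (F.map (biprod.desc v (-g)).op).hom ψ = (F.map biprod.fst.op).hom φ :=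
      (ShortComplex.ab_exact_iff _).1 (F.map_distinguished_op_exact _ mem) _ (by
        rw [op_comp, F.map_comp] at hφ
        exact hφ)
    have key : ∀ {r : T} (i : r ⟶ a ⊞ d), (F.map (i ≫ biprod.desc v (-g)).op).hom ψ =
        (F.map (i ≫ biprod.fst).op).hom φ := fun i => by
      rw [op_comp, op_comp, F.map_comp, F.map_comp]
      exact congrArg (F.map i.op).hom hψ
    refine ⟨ψ, ?_, ?_⟩
    · have h1 := key biprod.inl
      rw [biprod.inl_desc, biprod.inl_fst, op_id, CategoryTheory.Functor.map_id] at h1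
      exact h1
    · have h1 := key biprod.inr
      rw [biprod.inr_desc, biprod.inr_fst, op_zero, op_neg, Functor.map_neg,
        Functor.map_zero] at h1
      exact neg_eq_zero.1 h1

variable {X Y : Tᵒᵖ ⥤ AddCommGrpCat.{v}}

/-- The kernel of `T(-, a) ⟶ Y` for a finitely presentable `Y` is finitely generated. -/
lemma Presentation.exists_kernel_cover (Q : Presentation Y) {a : T}
    (q : preadditiveYoneda.obj a ⟶ Y) :
    ∃ (e : T) (i : e ⟶ a), ∀ {t : T} (s : t ⟶ a), evalHom q s = 0 ↔ ∃ k : t ⟶ e, k ≫ i = s := by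
  -- Lifting `q` to a map `v` between generators turns `q(s) = 0` into a factorization of `s ≫ v`
  -- through `Q.g`, which the weak pullback parametrizes.
  obtain ⟨v, hv⟩ := Q.exists_eq (evalHom q (𝟙 a))
  have hq : ∀ {t : T} (s : t ⟶ a), evalHom q s = evalHom Q.p (s ≫ v) := fun s => by
    rw [evalHom_eq_map, ← hv, map_evalHom]
  obtain ⟨e, i, j, hij, hlift, -⟩ := exists_weakPullback v Q.g
  refine ⟨e, i, fun s => ?_⟩
  rw [hq, Q.eq_zero_iff]
  constructor
  · rintro ⟨l, hl⟩
    exact hlift s l hl.symm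
  · rintro ⟨k, rfl⟩
    exact ⟨k ≫ j, by rw [Category.assoc, Category.assoc, hij]⟩

/-- A finitely generated submodule of a finitely presentable module is finitely presentable. -/
lemma Presentation.nonempty_of_mono (P : Presentation X) (m : Y ⟶ X) [Mono m] {e : T}
    (q : preadditiveYoneda.obj e ⟶ Y)
    (hq : ∀ {t : T} (a : Y.obj (op t)), ∃ s : t ⟶ e, evalHom q s = a) :
    Nonempty (Presentation Y) := by
  obtain ⟨e', i, hi⟩ := P.exists_kernel_cover (q ≫ m)
  refine ⟨⟨e, e', i, q, hq, fun {t} s => ?_⟩⟩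
  rw [← hi, evalHom_comp]
  exact (map_eq_zero_iff (m.app (op t)).hom ((mono_iff_elements m).1 inferInstance t)).symm

lemma Presentation.nonempty_kernel (P : Presentation X) (Q : Presentation Y) (f : X ⟶ Y) :
    Nonempty (Presentation (kernel f)) := by
  obtain ⟨e, i, hi⟩ := Q.exists_kernel_cover (P.p ≫ f)
  have h0 : (preadditiveYoneda.map i ≫ P.p) ≫ f = 0 := evalHom_ext ((hi _).2 ⟨𝟙 e, rfl⟩)
  refine P.nonempty_of_mono (kernel.ι f) (kernel.lift f _ h0) fun {t} a => ?_
  obtain ⟨s, hs⟩ := P.exists_eq (((kernel.ι f).app (op t)).hom a)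
  obtain ⟨k, rfl⟩ := (hi s).1 (by
    rw [evalHom_comp, hs]
    exact ConcreteCategory.congr_hom (NatTrans.congr_app (kernel.condition f) (op t)) a)
  refine ⟨k, (mono_iff_elements (kernel.ι f)).1 inferInstance t ?_⟩
  rw [← hs, ← evalHom_comp, kernel.lift_ι, evalHom_map_comp]

lemma Presentation.nonempty_cokernel (P : Presentation X) (Q : Presentation Y) (f : X ⟶ Y) :
    Nonempty (Presentation (cokernel f)) := by
  obtain ⟨v, hv⟩ := Q.exists_eq (evalHom (P.p ≫ f) (𝟙 P.x))
  have hf : ∀ {t : T} (s : t ⟶ P.x),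
      (f.app (op t)).hom (evalHom P.p s) = evalHom Q.p (s ≫ v) := fun s => by
    rw [← evalHom_comp, evalHom_eq_map, ← hv, map_evalHom]
  -- The generators of the source, mapped by `v`, become additional relations.
  refine ⟨⟨Q.x, P.x ⊞ Q.y, biprod.desc v Q.g, Q.p ≫ cokernel.π f,
    fun {t} a => (epi_iff_elements (Q.p ≫ cokernel.π f)).1 inferInstance t a, fun {t} s => ?_⟩⟩
  constructor
  · intro hs
    obtain ⟨b, hb⟩ := (exact_iff_elements _).1 (ShortComplex.exact_cokernel f) t (evalHom Q.p s) hs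
    obtain ⟨r, rfl⟩ := P.exists_eq b
    obtain ⟨l, hl⟩ := (Q.eq_zero_iff (s - r ≫ v)).1 (by
      rw [evalHom_sub, sub_eq_zero, ← hf]
      exact hb.symm)
    exact ⟨biprod.lift r l, by rw [biprod.lift_desc, hl, add_sub_cancel]⟩
  · rintro ⟨k, rfl⟩
    rw [biprod.desc_eq, Preadditive.comp_add, evalHom_add]
    have h1 : evalHom Q.p (k ≫ biprod.snd ≫ Q.g) = 0 :=
      (Q.eq_zero_iff _).2 ⟨k ≫ biprod.snd, Category.assoc _ _ _⟩
    rw [evalHom_comp, evalHom_comp, h1, map_zero, add_zero, ← Category.assoc, ← hf]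
    exact ConcreteCategory.congr_hom (NatTrans.congr_app (cokernel.condition f) (op t)) _

lemma Presentation.nonempty_biprod (P : Presentation X) (Q : Presentation Y) :
    Nonempty (Presentation (X ⊞ Y)) := by
  let p : preadditiveYoneda.obj (P.x ⊞ Q.x) ⟶ X ⊞ Y :=
    biprod.lift (preadditiveYoneda.map biprod.fst ≫ P.p) (preadditiveYoneda.map biprod.snd ≫ Q.p)
  have hfst : ∀ {t : T} (s : t ⟶ P.x ⊞ Q.x),
      ((biprod.fst : X ⊞ Y ⟶ X).app (op t)).hom (evalHom p s) =
        evalHom P.p (s ≫ biprod.fst) := fun s => by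
    rw [← evalHom_comp, biprod.lift_fst, evalHom_map_comp]
  have hsnd : ∀ {t : T} (s : t ⟶ P.x ⊞ Q.x),
      ((biprod.snd : X ⊞ Y ⟶ Y).app (op t)).hom (evalHom p s) =
        evalHom Q.p (s ≫ biprod.snd) := fun s => by
    rw [← evalHom_comp, biprod.lift_snd, evalHom_map_comp]
  have hext : ∀ {t : T} (a b : (X ⊞ Y).obj (op t)),
      ((biprod.fst : X ⊞ Y ⟶ X).app (op t)).hom a = ((biprod.fst : X ⊞ Y ⟶ X).app (op t)).hom b →
      ((biprod.snd : X ⊞ Y ⟶ Y).app (op t)).hom a = ((biprod.snd : X ⊞ Y ⟶ Y).app (op t)).hom b →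
      a = b := by
    intro t a b h₁ h₂
    have h : ∀ a : (X ⊞ Y).obj (op t), a =
        ((biprod.inl : X ⟶ X ⊞ Y).app (op t)).hom (((biprod.fst : X ⊞ Y ⟶ X).app (op t)).hom a) +
        ((biprod.inr : Y ⟶ X ⊞ Y).app (op t)).hom
          (((biprod.snd : X ⊞ Y ⟶ Y).app (op t)).hom a) := fun a =>
      (ConcreteCategory.congr_hom (NatTrans.congr_app (biprod.total (X := X) (Y := Y)) (op t))
        a).symm
    rw [h a, h b, h₁, h₂]
  refine ⟨⟨P.x ⊞ Q.x, P.y ⊞ Q.y, biprod.map P.g Q.g, p, fun {t} a => ?_, fun {t} s => ?_⟩⟩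
  · obtain ⟨s, hs⟩ := P.exists_eq (((biprod.fst : X ⊞ Y ⟶ X).app (op t)).hom a)
    obtain ⟨s', hs'⟩ := Q.exists_eq (((biprod.snd : X ⊞ Y ⟶ Y).app (op t)).hom a)
    refine ⟨biprod.lift s s', hext _ _ ?_ ?_⟩
    · rw [hfst, biprod.lift_fst, hs]
    · rw [hsnd, biprod.lift_snd, hs']
  · constructor
    · intro hs
      obtain ⟨k, hk⟩ := (P.eq_zero_iff (s ≫ biprod.fst)).1 (by rw [← hfst, hs, map_zero])
      obtain ⟨l, hl⟩ := (Q.eq_zero_iff (s ≫ biprod.snd)).1 (by rw [← hsnd, hs, map_zero])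
      exact ⟨biprod.lift k l, by ext <;> simp [hk, hl]⟩
    · rintro ⟨k, rfl⟩
      refine hext _ _ ?_ ?_
      · rw [hfst, map_zero, Category.assoc, biprod.map_fst, P.eq_zero_iff]
        exact ⟨k ≫ biprod.fst, Category.assoc _ _ _⟩
      · rw [hsnd, map_zero, Category.assoc, biprod.map_snd, Q.eq_zero_iff]
        exact ⟨k ≫ biprod.snd, Category.assoc _ _ _⟩

instance : (finitelyPresentable T).IsClosedUnderKernels where
  kernels_le := by
    rintro _ ⟨f, k, hk, hX, hY⟩
    rw [finitelyPresentable_iff] at hX hY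
    exact (finitelyPresentable T).prop_of_iso
      (IsLimit.conePointUniqueUpToIso (kernelIsKernel f) hk)
      ((finitelyPresentable_iff _).2 (hX.some.nonempty_kernel hY.some f))

instance : (finitelyPresentable T).IsClosedUnderCokernels where
  cokernels_le := by
    rintro _ ⟨f, k, hk, hX, hY⟩
    rw [finitelyPresentable_iff] at hX hY
    exact (finitelyPresentable T).prop_of_iso
      (IsColimit.coconePointUniqueUpToIso (cokernelIsCokernel f) hk)
      ((finitelyPresentable_iff _).2 (hX.some.nonempty_cokernel hY.some f))

instance : (finitelyPresentable T).ContainsZero where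
  exists_zero := by
    refine ⟨preadditiveYoneda.obj 0, ?_, (finitelyPresentable_iff _).2 ⟨.yoneda 0⟩⟩
    rw [IsZero.iff_id_eq_zero]
    exact evalHom_ext ((isZero_zero T).eq_of_tgt _ _)

instance : (finitelyPresentable T).IsClosedUnderBinaryProducts where
  limitsOfShape_le := by
    rintro X ⟨h⟩
    have hP := h.prop_diag_obj
    let e := IsLimit.conePointsIsoOfNatIso
      (BinaryBiproduct.isLimit (h.diag.obj ⟨.left⟩) (h.diag.obj ⟨.right⟩))
      h.isLimit (diagramIsoPair h.diag).symm
    refine (finitelyPresentable T).prop_of_iso e ((finitelyPresentable_iff _).2 ?_)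
    exact ((finitelyPresentable_iff _).1 (hP ⟨.left⟩)).some.nonempty_biprod
      ((finitelyPresentable_iff _).1 (hP ⟨.right⟩)).some

instance : (finitelyPresentable T).IsClosedUnderFiniteProducts := .mk'

instance : (finitelyPresentable T).ι.PreservesHomology where
  preservesKernels _ _ f := (finitelyPresentable T).preservesKernels_ι f
  preservesCokernels _ _ f := (finitelyPresentable T).preservesCokernels_ι f

/-! ### Homological functors are injective relative to finitely presentable modules -/

/-- Morphisms to a homological functor extend along monomorphisms of finitely presentable
modules. -/
lemma Presentation.exists_extension (P : Presentation X) (Q : Presentation Y) (m : X ⟶ Y) [Mono m]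
    (F : Tᵒᵖ ⥤ AddCommGrpCat.{v}) [F.IsHomological] (φ : X ⟶ F) : ∃ ψ : Y ⟶ F, m ≫ ψ = φ := by
  obtain ⟨v, hv⟩ := Q.exists_eq ((m.app _).hom (evalHom P.p (𝟙 P.x)))
  obtain ⟨e, i, j, hij, -, hF⟩ := exists_weakPullback v Q.g
  -- As `m` is injective this can be tested in `Y`, where `i ≫ v = j ≫ Q.g` is a relation. So `φ`
  -- vanishes on `i`, and its generator extends to an element of `F(Q.x)` killed by the relations of
  -- `Y`.
  have hi : evalHom P.p i = 0 := by
    refine (mono_iff_elements m).1 inferInstance e ?_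
    rw [map_zero, evalHom_eq_map, naturality_apply, ← hv, map_evalHom, Q.eq_zero_iff]
    exact ⟨j, hij.symm⟩
  obtain ⟨ψ₀, hψv, hψg⟩ := hF F ((φ.app _).hom (evalHom P.p (𝟙 P.x))) (by
    rw [← naturality_apply, ← evalHom_eq_map, hi, map_zero])
  obtain ⟨ψ, hψ⟩ := Q.exists_desc ψ₀ hψg
  refine ⟨ψ, P.hom_ext ?_⟩
  change (ψ.app _).hom ((m.app _).hom (evalHom P.p (𝟙 P.x))) = _
  rw [← hv, evalHom_eq_map, naturality_apply, hψ, hψv]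

instance (F : Tᵒᵖ ⥤ AddCommGrpCat.{v}) : (homInto F).Additive where
  map_add {X Y f g} := by
    ext φ
    exact Preadditive.add_comp (C := Tᵒᵖ ⥤ AddCommGrpCat.{v}) _ _ _ f.unop.hom g.unop.hom φ

/-- For a homological functor `F`, the functor `Hom(-, F)` is exact on `A(T)`. -/
lemma exact_map_homInto (F : Tᵒᵖ ⥤ AddCommGrpCat.{v}) [F.IsHomological]
    (S : ShortComplex (Abelianization T)ᵒᵖ) (hS : S.Exact) : (S.map (homInto F)).Exact := by
  revert S hS
  -- Short exact sequences suffice; only surjectivity on the right needs `F` homological, through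
  -- extension along monomorphisms.
  refine ((homInto F).exact_tfae.out 0 1).1 fun S hS => ?_
  have hS' := hS.unop
  have := (finitelyPresentable T).preservesMonomorphisms_ι_of_isNormalEpiCategory
  have := (finitelyPresentable T).preservesEpimorphisms_ι_of_isNormalMonoCategory
  have hex := hS'.exact.map (finitelyPresentable T).ι
  have : Mono S.unop.f := hS'.mono_f
  have : Epi S.unop.g := hS'.epi_g
  have hm : Mono S.unop.f.hom := inferInstanceAs (Mono ((finitelyPresentable T).ι.map S.unop.f))
  have he : Epi S.unop.g.hom := inferInstanceAs (Epi ((finitelyPresentable T).ι.map S.unop.g))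
  exact
    { exact := by
        rw [ShortComplex.ab_exact_iff]
        intro φ hφ
        have : Epi (S.unop.map (finitelyPresentable T).ι).g := he
        exact ⟨hex.desc φ hφ, hex.g_desc φ hφ⟩
      mono_f := by
        rw [AddCommGrpCat.mono_iff_injective]
        intro a b hab
        exact (cancel_epi S.unop.g.hom).1 hab
      epi_g := by
        rw [AddCommGrpCat.epi_iff_surjective]
        intro φ
        exact (presentation _).exists_extension (presentation _) S.unop.f.hom F φ }

end Triangulated

end KAbExample

end
noncomputable section

namespace KAbExample

/-! ### Coproducts in the abelianization -/

section Coproducts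

variable {T : Type w} [Category.{v} T] [Preadditive T]

/-- Representables send coproducts to products, and products of abelian groups are exact, so the
cokernel of a map of representables does too: lift relations for injectivity, generators for
surjectivity. -/
lemma Presentation.sendsCoproductsToProducts {X : Tᵒᵖ ⥤ AddCommGrpCat.{v}}
    (P : Presentation X) : SendsCoproductsToProducts X := by
  rintro J t c ⟨hc⟩
  constructor
  · intro a b hab
    obtain ⟨s, hs⟩ := P.exists_eq (a - b)
    have h : ∀ j, (X.map (c.inj j).op).hom (evalHom P.p s) = 0 := fun j => by
      rw [hs, map_sub, sub_eq_zero]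
      exact congrFun hab j
    rw [← sub_eq_zero, ← hs]
    have h' : ∀ j, ∃ k : t j ⟶ P.y, k ≫ P.g = c.inj j ≫ s := fun j => by
      rw [← P.eq_zero_iff, ← map_evalHom]
      exact h j
    choose k hk using h'
    rw [P.eq_zero_iff]
    refine ⟨Cofan.IsColimit.desc hc k, Cofan.IsColimit.hom_ext hc _ _ fun j => ?_⟩
    rw [← hk, ← Category.assoc, Cofan.IsColimit.fac]
  · intro a
    choose s hs using fun j => P.exists_eq (a j)
    refine ⟨evalHom P.p (Cofan.IsColimit.desc hc s), ?_⟩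
    funext j
    dsimp only
    rw [map_evalHom, Cofan.IsColimit.fac, hs]

/-- A cofan of modules arising from coproduct cofans of generators and relations is a coproduct
with respect to all functors sending coproducts to products. -/
lemma Presentation.bijective_comp {J : Type v} {X : J → Tᵒᵖ ⥤ AddCommGrpCat.{v}}
    {C : Tᵒᵖ ⥤ AddCommGrpCat.{v}} (P : ∀ j, Presentation (X j)) (Q : Presentation C)
    (a : ∀ j, (P j).x ⟶ Q.x) (b : ∀ j, (P j).y ⟶ Q.y)
    (ha : IsColimit (Cofan.mk Q.x a)) (hb : IsColimit (Cofan.mk Q.y b))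
    (hab : ∀ j, (P j).g ≫ a j = b j ≫ Q.g) (i : ∀ j, X j ⟶ C)
    (hi : ∀ j, ((i j).app _).hom (evalHom (P j).p (𝟙 (P j).x)) = evalHom Q.p (a j))
    (Z : Tᵒᵖ ⥤ AddCommGrpCat.{v}) [Z.Additive] (hZ : SendsCoproductsToProducts Z) :
    Function.Bijective (fun (φ : C ⟶ Z) (j : J) => i j ≫ φ) := by
  have hZa : Function.Bijective (fun (z : Z.obj (op Q.x)) j => (Z.map (a j).op).hom z) :=
    hZ J _ _ ⟨ha⟩
  have hZb : Function.Bijective (fun (z : Z.obj (op Q.y)) j => (Z.map (b j).op).hom z) :=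
    hZ J _ _ ⟨hb⟩
  have key : ∀ (φ : C ⟶ Z) (j : J),
      (Z.map (a j).op).hom ((φ.app _).hom (evalHom Q.p (𝟙 Q.x))) =
      ((i j ≫ φ).app _).hom (evalHom (P j).p (𝟙 (P j).x)) := fun φ j => by
    rw [← naturality_apply, ← evalHom_eq_map, ← hi]
    rfl
  constructor
  · intro φ φ' h
    refine Q.hom_ext (hZa.1 ?_)
    funext j
    dsimp only
    rw [key, key, show i j ≫ φ = i j ≫ φ' from congrFun h j]
  · intro ψ
    -- The images of the generators glue to one element over `Q.x`; that the relations kill it is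
    -- checked on the components of `Q.y`.
    obtain ⟨γ, hγ⟩ := hZa.2 fun j => ((ψ j).app _).hom (evalHom (P j).p (𝟙 (P j).x))
    have hgen : ∀ j, (Z.map (a j).op).hom γ =
      ((ψ j).app _).hom (evalHom (P j).p (𝟙 (P j).x)) := congrFun hγ
    obtain ⟨φ, hφ⟩ := Q.exists_desc γ (hZb.1 (by
      funext j
      have h1 : (Z.map (b j ≫ Q.g).op).hom γ = 0 := by
        rw [← hab, op_comp, Z.map_comp]
        change (Z.map (P j).g.op).hom ((Z.map (a j).op).hom γ) = 0
        rw [hgen, ← naturality_apply, (P j).map_g_generator, map_zero]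
      rw [op_comp, Z.map_comp] at h1
      exact h1.trans (map_zero _).symm))
    refine ⟨φ, ?_⟩
    funext j
    refine (P j).hom_ext ?_
    rw [← key, hφ, hgen]

/-- Coproducts of finitely presentable modules: they are coproducts with respect to all functors
sending coproducts to products. -/
lemma exists_cofan_bijective [HasCoproducts.{v} T] {J : Type v} (X : J → Abelianization T) :
    ∃ c : Cofan X, ∀ (Z : Tᵒᵖ ⥤ AddCommGrpCat.{v}) [Z.Additive], SendsCoproductsToProducts Z →
      Function.Bijective (fun (φ : c.pt.obj ⟶ Z) (j : J) => (c.inj j).hom ≫ φ) := by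
  obtain ⟨P⟩ : Nonempty (∀ j, Presentation (X j).obj) := ⟨fun j => presentation (X j)⟩
  let g : (∐ fun j => (P j).y) ⟶ ∐ fun j => (P j).x := Limits.Sigma.map fun j => (P j).g
  obtain ⟨C, Q, a, b, ha, hb, hab⟩ : ∃ (C : Tᵒᵖ ⥤ AddCommGrpCat.{v}) (Q : Presentation C)
      (a : ∀ j, (P j).x ⟶ Q.x) (b : ∀ j, (P j).y ⟶ Q.y)
      (_ : IsColimit (Cofan.mk Q.x a)) (_ : IsColimit (Cofan.mk Q.y b)),
      ∀ j, (P j).g ≫ a j = b j ≫ Q.g :=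
    ⟨_, Presentation.ofHom g, Sigma.ι (fun j => (P j).x), Sigma.ι (fun j => (P j).y),
      coproductIsCoproduct _, coproductIsCoproduct _,
      fun j => (Limits.Sigma.ι_map (fun j => (P j).g) j).symm⟩
  have := Q.additive
  choose i hi using fun j => (P j).exists_desc (evalHom Q.p (a j)) (by
    rw [map_evalHom, hab, Q.eq_zero_iff]
    exact ⟨_, rfl⟩)
  exact ⟨Cofan.mk ⟨C, (finitelyPresentable_iff _).2 ⟨Q⟩⟩ fun j => ObjectProperty.homMk (i j),
    fun Z _ hZ => Presentation.bijective_comp P Q a b ha hb hab i hi Z hZ⟩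

/-- `A(T)` is a full subcategory of modules, so testing on underlying modules is enough. -/
lemma isColimit_of_bijective {J : Type v} {X : J → Abelianization T} (c : Cofan X)
    (hc : ∀ Y : Abelianization T,
      Function.Bijective (fun (φ : c.pt.obj ⟶ Y.obj) (j : J) => (c.inj j).hom ≫ φ)) :
    Nonempty (IsColimit c) := by
  choose φ hφ using fun s : Cofan X => (hc s.pt).2 fun j => (s.inj j).hom
  refine ⟨Cofan.IsColimit.mk c (fun s => ObjectProperty.homMk (φ s)) (fun s j => ?_)
    fun s m hm => ?_⟩
  · ext1
    exact congrFun (hφ s) j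
  · ext1
    refine (hc s.pt).1 ?_
    funext j
    exact (congrArg (fun f => f.hom) (hm j)).trans (congrFun (hφ s) j).symm

lemma hasCoproducts_abelianization [HasCoproducts.{v} T] :
    HasCoproducts.{v} (Abelianization T) := by
  intro J
  suffices h : ∀ X : J → Abelianization T, HasColimit (Discrete.functor X) from
    ⟨fun K => have := h (K.obj ∘ Discrete.mk); hasColimit_of_iso Discrete.natIsoFunctor⟩
  intro X
  obtain ⟨c, hc⟩ := exists_cofan_bijective X
  obtain ⟨hcol⟩ := isColimit_of_bijective c fun Y =>
    hc Y.obj (presentation Y).sendsCoproductsToProducts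
  exact ⟨⟨⟨c, hcol⟩⟩⟩

/-- If `F` sends coproducts to products, then so does `Hom(-, F)` on `A(T)`. -/
lemma bijective_homInto [HasCoproducts.{v} T] (F : Tᵒᵖ ⥤ AddCommGrpCat.{v}) [F.Additive]
    (hF : SendsCoproductsToProducts F) {J : Type v} (X : J → Abelianization T) (c : Cofan X)
    (hc : IsColimit c) :
    Function.Bijective (fun (φ : c.pt.obj ⟶ F) (j : J) => (c.inj j).hom ≫ φ) := by
  obtain ⟨c', hc'⟩ := exists_cofan_bijective X
  obtain ⟨hcol⟩ := isColimit_of_bijective c' fun Y =>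
    hc' Y.obj (presentation Y).sendsCoproductsToProducts
  let e : c'.pt ≅ c.pt := hcol.coconePointUniqueUpToIso hc
  have he : ∀ j, c'.inj j ≫ e.hom = c.inj j := fun j =>
    hcol.comp_coconePointUniqueUpToIso_hom hc ⟨j⟩
  let e' : c'.pt.obj ≅ c.pt.obj := (finitelyPresentable T).ι.mapIso e
  have he' : (fun (φ : c.pt.obj ⟶ F) (j : J) => (c.inj j).hom ≫ φ) =
      (fun (φ : c'.pt.obj ⟶ F) (j : J) => (c'.inj j).hom ≫ φ) ∘ fun φ => e'.hom ≫ φ := by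
    funext φ j
    rw [← he]
    exact Category.assoc _ _ _
  rw [he']
  exact (hc' F hF).comp e'.symm.homFromEquiv.bijective

end Coproducts

end KAbExample

end
noncomputable section

namespace KAbExample

/-! ### Functors with small values -/

section Shrink

variable {C : Type w} [Category.{v} C] (G : C ⥤ AddCommGrpCat.{u + 1})
  [∀ X, Small.{u} (G.obj X)]

/-- A functor to abelian groups with small values, as a functor to small abelian groups. -/
def shrinkFunctor : C ⥤ AddCommGrpCat.{u} where
  obj X := AddCommGrpCat.of (Shrink.{u} (G.obj X))
  map f := AddCommGrpCat.ofHom ((Shrink.addEquiv.symm.toAddMonoidHom.comp (G.map f).hom).comp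
    Shrink.addEquiv.toAddMonoidHom)
  map_id X := by
    ext x
    simp
  map_comp f g := by
    ext x
    simp

/-- The values of `shrinkFunctor G` are the values of `G`. -/
def shrinkFunctorEquiv (X : C) : (shrinkFunctor G).obj X ≃+ G.obj X := Shrink.addEquiv

lemma shrinkFunctorEquiv_map {X Y : C} (f : X ⟶ Y) (a : (shrinkFunctor G).obj X) :
    shrinkFunctorEquiv G Y (((shrinkFunctor G).map f).hom a) =
      (G.map f).hom (shrinkFunctorEquiv G X a) :=
  Shrink.addEquiv.apply_symm_apply _

/-- The universe lift of `shrinkFunctor G` is `G`. -/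
def shrinkFunctorCompIso : shrinkFunctor G ⋙ AddCommGrpCat.uliftFunctor.{u + 1, u} ≅ G :=
  NatIso.ofComponents
    (fun X => (AddEquiv.ulift.trans (shrinkFunctorEquiv G X)).toAddCommGrpIso) fun f => by
      ext a
      exact shrinkFunctorEquiv_map G f a.down

lemma exact_map_shrinkFunctor [Preadditive C] [G.PreservesZeroMorphisms]
    [(shrinkFunctor G).PreservesZeroMorphisms] (S : ShortComplex C) (hS : (S.map G).Exact) :
    (S.map (shrinkFunctor G)).Exact := by
  rw [ShortComplex.ab_exact_iff] at hS ⊢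
  intro a ha
  obtain ⟨b, hb⟩ := hS (shrinkFunctorEquiv G _ a) (by
    refine (shrinkFunctorEquiv_map G S.g a).symm.trans ?_
    exact (congrArg _ ha).trans (map_zero _))
  refine ⟨(shrinkFunctorEquiv G _).symm b, (shrinkFunctorEquiv G _).injective ?_⟩
  exact (shrinkFunctorEquiv_map G S.f _).trans
    ((congrArg (G.map S.f).hom ((shrinkFunctorEquiv G _).apply_symm_apply b)).trans hb)

instance [Preadditive C] [G.Additive] : (shrinkFunctor G).Additive where
  map_add {X Y f g} := by
    ext a
    refine (shrinkFunctorEquiv G Y).injective ?_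
    refine (shrinkFunctorEquiv_map G (f + g) a).trans ?_
    rw [G.map_add]
    refine Eq.trans ?_ (map_add (shrinkFunctorEquiv G Y) _ _).symm
    rw [shrinkFunctorEquiv_map, shrinkFunctorEquiv_map]
    rfl

end Shrink

/-! ### The product functor -/

section ClassProduct

instance (Y : RegularCardinal.{u} → KAb.{u}) : (classProduct Y).Additive where
  map_add {X X' f g} := by
    ext a
    funext κ
    exact Preadditive.add_comp _ _ _ f.unop g.unop (a κ)

instance (Y : RegularCardinal.{u} → KAb.{u}) : (classProduct Y).IsHomological where
  exact D hD := by
    rw [ShortComplex.ab_exact_iff]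
    intro a ha
    have h : ∀ κ, ∃ b, a κ = D.mor₁.unop ≫ b := fun κ =>
      Pretriangulated.Triangle.yoneda_exact₂ _ (Pretriangulated.unop_distinguished D hD) (a κ)
        (congrFun ha κ)
    choose b hb using h
    exact ⟨b, funext fun κ => (hb κ).symm⟩

lemma bijective_classProduct (Y : RegularCardinal.{u} → KAb.{u}) {J : Type u} {X : J → KAb.{u}}
    (c : Cofan X) (hc : IsColimit c) :
    Function.Bijective (fun (x : (classProduct Y).obj (op c.pt)) (j : J) =>
      ((classProduct Y).map (c.inj j).op).hom x) := by
  constructor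
  · intro a b hab
    funext κ
    exact Cofan.IsColimit.hom_ext hc _ _ fun j => congrFun (congrFun hab j) κ
  · intro a
    refine ⟨fun κ => Cofan.IsColimit.desc hc fun j => a j κ, ?_⟩
    funext j κ
    exact Cofan.IsColimit.fac hc _ j

variable (c : ∀ κ : RegularCardinal.{u}, ℕ → ∀ B : AddCommGrpCat.{u}, Precover κ.1 B)

/-- The functor `F = ∏_κ K(Ab)(-, Y_{ℤ^κ, κ})`, with values in small abelian groups. -/
def smallProduct : KAb.{u}ᵒᵖ ⥤ AddCommGrpCat.{u} :=
  shrinkFunctor (classProduct (resolutionIntPower c))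

instance : (smallProduct c).Additive :=
  inferInstanceAs (shrinkFunctor _).Additive

instance : (smallProduct c).IsHomological where
  exact D hD := exact_map_shrinkFunctor _ _ (Functor.map_distinguished_exact _ D hD)

/-- If `G` maps a cofan bijectively to a product, then so does `shrinkFunctor G`. -/
lemma bijective_shrinkFunctor {C : Type w} [Category.{v} C] (G : Cᵒᵖ ⥤ AddCommGrpCat.{u + 1})
    [∀ X, Small.{u} (G.obj X)] {J : Type u} {X : J → C} (c : Cofan X)
    (h : Function.Bijective (fun (x : G.obj (op c.pt)) (j : J) => (G.map (c.inj j).op).hom x)) :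
    Function.Bijective (fun (x : (shrinkFunctor G).obj (op c.pt)) (j : J) =>
      ((shrinkFunctor G).map (c.inj j).op).hom x) := by
  constructor
  · intro a b hab
    refine (shrinkFunctorEquiv G _).injective (h.1 ?_)
    funext j
    exact (shrinkFunctorEquiv_map G _ a).symm.trans
      ((congrArg _ (congrFun hab j)).trans (shrinkFunctorEquiv_map G _ b))
  · intro a
    obtain ⟨b, hb⟩ := h.2 fun j => shrinkFunctorEquiv G _ (a j)
    refine ⟨(shrinkFunctorEquiv G _).symm b, ?_⟩
    funext j
    refine (shrinkFunctorEquiv G _).injective ((shrinkFunctorEquiv_map G _ _).trans ?_)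
    rw [AddEquiv.apply_symm_apply]
    exact congrFun hb j

lemma sendsCoproductsToProducts_smallProduct : SendsCoproductsToProducts (smallProduct c) :=
  fun _ _ t ⟨ht⟩ => bijective_shrinkFunctor _ t (bijective_classProduct _ t ht)

/-- The projection `F ⟶ K(Ab)(-, Y_{ℤ^κ, κ})`. -/
def smallProductπ (κ : RegularCardinal.{u}) :
    smallProduct c ⟶ preadditiveYoneda.obj (resolutionIntPower c κ) where
  app X := AddCommGrpCat.ofHom
    ((Pi.evalAddMonoidHom (fun κ => X.unop ⟶ resolutionIntPower c κ) κ).comp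
      (shrinkFunctorEquiv (classProduct (resolutionIntPower c)) X).toAddMonoidHom)
  naturality X X' f := by
    ext a
    exact congrFun (shrinkFunctorEquiv_map (classProduct (resolutionIntPower c)) f a) κ

/-- The functor `F` is not a quotient of a representable functor. -/
lemma not_epi_smallProduct (Z : KAb.{u}) (q : preadditiveYoneda.obj Z ⟶ smallProduct c)
    (hq : ∀ {t : KAb.{u}} (a : (smallProduct c).obj (op t)), ∃ s : t ⟶ Z, evalHom q s = a) :
    False := by
  classical
  obtain ⟨κ, hκ⟩ := exists_resolutionIntPower_not_retract c Z
  obtain ⟨b, hb⟩ : ∃ b : (classProduct (resolutionIntPower c)).obj (op (resolutionIntPower c κ)),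
      b κ = 𝟙 (resolutionIntPower c κ) := ⟨Pi.single κ (𝟙 _), Pi.single_eq_same κ _⟩
  obtain ⟨s, hs⟩ :=
    hq ((shrinkFunctorEquiv (classProduct (resolutionIntPower c)) _).symm b)
  refine hκ s (evalHom (q ≫ smallProductπ c κ) (𝟙 Z)) ?_
  have h1 : evalHom (q ≫ smallProductπ c κ) s = 𝟙 (resolutionIntPower c κ) := by
    rw [evalHom_comp, hs]
    exact (congrFun ((shrinkFunctorEquiv (classProduct (resolutionIntPower c)) _).apply_symm_apply
      b) κ).trans hb
  rw [evalHom_eq_map] at h1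
  exact h1

lemma not_isRepresentableAb_smallProduct : ¬ IsRepresentableAb.{u, u} (smallProduct c) := by
  rintro ⟨Z, ⟨e⟩⟩
  -- The universe lift in the definition of representability is only formal here; `d` strips it.
  let d : smallProduct c ⋙ AddCommGrpCat.uliftFunctor.{u, u} ⟶ smallProduct c :=
    { app := fun X => AddCommGrpCat.ofHom AddEquiv.ulift.toAddMonoidHom
      naturality := fun X Y f => by
        ext a
        rfl }
  refine not_epi_smallProduct c Z (e.inv ≫ d) fun {t} a => ?_
  refine ⟨(e.hom.app (op t)).hom ⟨a⟩, ?_⟩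
  change (d.app (op t)).hom ((e.hom.app (op t) ≫ e.inv.app (op t)).hom ⟨a⟩) = a
  rw [Iso.hom_inv_id_app]
  rfl

/-! ### The functor on the abelianization -/

instance small_homInto_obj {T : Type (u + 1)} [Category.{u} T] [Preadditive T]
    (F : Tᵒᵖ ⥤ AddCommGrpCat.{u}) (X : (Abelianization T)ᵒᵖ) : Small.{u} ((homInto F).obj X) :=
  (presentation X.unop).small_hom F

/-- If `Hom(-, F)` is representable on `A(T)`, then `F` is a quotient of a representable
functor. -/
lemma exists_epi_of_homInto_iso {T : Type w} [Category.{v} T] [Preadditive T]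
    (F : Tᵒᵖ ⥤ AddCommGrpCat.{v}) [F.Additive] (X : Abelianization T)
    (e : homInto F ≅ preadditiveYoneda.obj X) :
    ∃ (z : T) (q : preadditiveYoneda.obj z ⟶ F),
      ∀ {t : T} (a : F.obj (op t)), ∃ s : t ⟶ z, evalHom q s = a := by
  -- The universal element. An element of `F(t)` is a map T(-, t) ⟶ F, and T(-, t) lies in `A(T)`,
  -- so it factors through `ω`.
  let ω : X.obj ⟶ F := (e.inv.app (op X)).hom (𝟙 X)
  let P := presentation X
  refine ⟨P.x, P.p ≫ ω, fun {t} a => ?_⟩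
  let R : Abelianization T :=
    ⟨preadditiveYoneda.obj t, (finitelyPresentable_iff _).2 ⟨.yoneda t⟩⟩
  let f : R ⟶ X := (e.hom.app (op R)).hom (homOfElement a)
  have hf : f.hom ≫ ω = homOfElement a := by
    have h1 := ConcreteCategory.congr_hom (e.inv.naturality f.op) (𝟙 X)
    have h2 : (e.inv.app (op R)).hom f = homOfElement a :=
      ConcreteCategory.congr_hom (e.hom_inv_id_app (op R)) (homOfElement a)
    have h3 : ((preadditiveYoneda.obj X).map f.op).hom (𝟙 X) = f := Category.comp_id f
    refine h1.symm.trans (Eq.trans ?_ h2)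
    exact congrArg (e.inv.app (op R)).hom h3
  obtain ⟨s, hs⟩ := P.exists_eq (evalHom f.hom (𝟙 t))
  refine ⟨s, ?_⟩
  rw [evalHom_comp, hs, ← evalHom_comp, hf, evalHom_homOfElement_id]

/-- The functor `F^* = Hom(-, F)`, with values in small abelian groups. -/
def smallHomInto : (Abelianization KAb.{u})ᵒᵖ ⥤ AddCommGrpCat.{u} :=
  shrinkFunctor (homInto (smallProduct c))

instance : (smallHomInto c).Additive :=
  inferInstanceAs (shrinkFunctor (homInto (smallProduct c))).Additive

lemma smallHomInto_exact :
    PreservesFiniteLimits (smallHomInto c) ∧ PreservesFiniteColimits (smallHomInto c) :=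
  ((smallHomInto c).exact_tfae.out 1 3).1 fun S hS =>
    exact_map_shrinkFunctor _ _ (exact_map_homInto (smallProduct c) S hS)

lemma sendsCoproductsToProducts_smallHomInto : SendsCoproductsToProducts (smallHomInto c) :=
  have := hasCoproducts_KAb.{u}
  fun _ X t ⟨ht⟩ => bijective_shrinkFunctor _ t
    (bijective_homInto (smallProduct c) (sendsCoproductsToProducts_smallProduct c) X t ht)

lemma not_isRepresentableAb_smallHomInto :
    ¬ IsRepresentableAb.{u, u + 1} (smallHomInto c) := by
  rintro ⟨X, ⟨e⟩⟩
  obtain ⟨z, q, hq⟩ := exists_epi_of_homInto_iso (smallProduct c) X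
    ((shrinkFunctorCompIso (homInto (smallProduct c))).symm ≪≫ e)
  exact not_epi_smallProduct c z q hq

end ClassProduct

end KAbExample

end

open KAbExample in
theorem mainTheorem8 :
    HasCoproducts.{u} KAb.{u} ∧
    Nonempty (Abelian (Abelianization KAb.{u})) ∧
    LocallySmall.{u} (Abelianization KAb.{u}) ∧
    HasCoproducts.{u} (Abelianization KAb.{u}) ∧
    (∀ (κ : RegularCardinal.{u}) (A : AddCommGrpCat.{u}), Nonempty (Precover κ.1 A)) ∧
    ∀ c : (∀ κ : RegularCardinal.{u}, ℕ → ∀ B : AddCommGrpCat.{u}, Precover κ.1 B),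
      ∃ F : KAb.{u}ᵒᵖ ⥤ AddCommGrpCat.{u},
        Nonempty (F ⋙ AddCommGrpCat.uliftFunctor.{u + 1, u} ≅
          classProduct (resolutionIntPower c)) ∧
        F.IsHomological ∧
        SendsCoproductsToProducts F ∧
        ¬ IsRepresentableAb.{u, u} F ∧
        ∃ Fstar : (Abelianization KAb.{u})ᵒᵖ ⥤ AddCommGrpCat.{u},
          Nonempty (Fstar ⋙ AddCommGrpCat.uliftFunctor.{u + 1, u} ≅ homInto F) ∧
          Fstar.Additive ∧
          PreservesFiniteLimits Fstar ∧
          PreservesFiniteColimits Fstar ∧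
          SendsCoproductsToProducts Fstar ∧
          ¬ IsRepresentableAb.{u, u + 1} Fstar := by
  refine ⟨hasCoproducts_KAb, ⟨inferInstance⟩, locallySmall_abelianization,
    have := hasCoproducts_KAb.{u}; hasCoproducts_abelianization,
    fun κ A => nonempty_precover κ.1 A, fun c => ?_⟩
  exact ⟨smallProduct c, ⟨shrinkFunctorCompIso _⟩, inferInstance,
    sendsCoproductsToProducts_smallProduct c, not_isRepresentableAb_smallProduct c,
    smallHomInto c, ⟨shrinkFunctorCompIso _⟩, inferInstance, (smallHomInto_exact c).1,
    (smallHomInto_exact c).2, sendsCoproductsToProducts_smallHomInto c,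
    not_isRepresentableAb_smallHomInto c⟩
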